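/- **Setting.** Let $X$ be a scheme with effective Cartier divisors $y=0$, $s=0$, $v_1=0$, $v_2=0$, $v_3=0$ whose (invertible) ideal sheaves satisfy $(y)\,(s)=(v_1)(v_2)(v_3)$; locally $y,s,v_1,v_2,v_3$ are nonzerodivisors with $ys=v_1v_2v_3$ up to a unit. The model case is the binomial variety $$X=V(ys-v_1v_2v_3)\subset\mathbb{A}^5_{\mathbb{C}}$$ with its five coordinate functions; another case is the partial resolution $\mathscr{B}$ of the $SU(5)$ model, with $v_1=e_1$, $v_2=e_2$, $v_3=t$. For $w\in\{y,s\}$ and $a\neq b$ in $\{1,2,3\}$, blow up the ideal $(w,v_a)$ and let $\ell$ be a local equation of the exceptional divisor. Then $w=\ell w'$, where $w'=0$ is called the proper transform of $w=0$; its ideal sheaf is the ideal quotient $((w):(\ell))$. * The Esole–Yau resolution $\mathscr{B}_{i,j}$ ($i\ne j$) is the $X$-scheme obtained by blowing up $(y,v_i)$ and then the inverse image of the ideal $(s,v_j)$. * The Hayashi–Lawrie–Schäfer-Nameki resolution $(1,a)(1,b)$ is the $X$-scheme obtained by blowing up $(y,v_a)$ and then $(y',v_b)$, where $y'$ is the proper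 transform of $y$ and $v_b$ is pulled back. * The resolution $(2,a)(2,b)$ is the $X$-scheme obtained by blowing up $(s,v_a)$ and then $(s',v_b)$, where $s'$ is the proper transform of $s$ and $v_b$ is pulled back. **Theorem.** Let $(i,j,k)$ be a permutation of $(1,2,3)$. For every such $X$, and in particular for the binomial variety $V(ys-v_1v_2v_3)\subset\mathbb{A}^5_{\mathbb{C}}$, there are isomorphisms of schemes over $X$ $$\mathscr{B}_{i,j}\;\cong\;(1,i)(1,k)\;\cong\;(2,j)(2,k).$$ -/

import Mathlib

open CategoryTheory AlgebraicGeometry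

universe u

/-! Gluing of charts: a functorial condition on morphisms to `X` that is local on the source and
is represented on suitable open loci by given charts has a terminal object. -/

namespace BlowupAux

open CategoryTheory.Limits

lemma isOpenCover_of_mem {Z : Scheme.{u}} (U : Z → Z.Opens) (hU : ∀ z, z ∈ U z) :
    TopologicalSpace.IsOpenCover U :=
  TopologicalSpace.IsOpenCover.mk
    (top_le_iff.mp fun z _ => TopologicalSpace.Opens.mem_iSup.mpr ⟨z, hU z⟩)

lemma hom_ext_of_mem {Z Y : Scheme.{u}} (U : Z → Z.Opens) (hU : ∀ z, z ∈ U z) (g h : Z ⟶ Y)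
    (e : ∀ z, (U z).ι ≫ g = (U z).ι ≫ h) : g = h :=
  (Z.openCoverOfIsOpenCover U (isOpenCover_of_mem U hU)).hom_ext _ _ e

lemma exists_glue {Z Y : Scheme.{u}} (U : Z → Z.Opens) (hU : ∀ z, z ∈ U z)
    (m : ∀ z, (U z).toScheme ⟶ Y)
    (hm : ∀ x y, pullback.fst (U x).ι (U y).ι ≫ m x = pullback.snd (U x).ι (U y).ι ≫ m y) :
    ∃ g : Z ⟶ Y, ∀ z, (U z).ι ≫ g = m z :=
  ⟨(Z.openCoverOfIsOpenCover U (isOpenCover_of_mem U hU)).glueMorphisms m hm, fun z =>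
    (Z.openCoverOfIsOpenCover U (isOpenCover_of_mem U hU)).ι_glueMorphisms m hm z⟩

structure ChartSystem (X : Scheme.{u}) (P : ∀ {Z : Scheme.{u}}, (Z ⟶ X) → Prop) where
  J : Type u
  T : J → Scheme.{u}
  τ : ∀ i, T i ⟶ X
  O : ∀ {Z : Scheme.{u}} (_ : Z ⟶ X) (_ : J), Z.Opens
  P_open : ∀ {W Z : Scheme.{u}} (j : W ⟶ Z) [IsOpenImmersion j] (f : Z ⟶ X), P f → P (j ≫ f)
  P_local : ∀ {Z : Scheme.{u}} (f : Z ⟶ X) (𝒰 : Scheme.OpenCover.{u} Z),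
    (∀ i, P (𝒰.f i ≫ f)) → P f
  P_τ : ∀ i, P (τ i)
  uniq : ∀ {Z : Scheme.{u}} (i : J) (g h : Z ⟶ T i), P (g ≫ τ i) → g ≫ τ i = h ≫ τ i → g = h
  lift : ∀ {Z : Scheme.{u}} (f : Z ⟶ X) (i : J), P f → O f i = ⊤ → ∃ g : Z ⟶ T i, g ≫ τ i = f
  O_comp : ∀ {W Z : Scheme.{u}} (g : W ⟶ Z) (f : Z ⟶ X) (i : J), P f → P (g ≫ f) →
    O (g ≫ f) i = g ⁻¹ᵁ (O f i)
  O_τ : ∀ i, O (τ i) i = ⊤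
  O_cover : ∀ {Z : Scheme.{u}} (f : Z ⟶ X), P f → ∀ z : Z, ∃ i, z ∈ O f i

namespace ChartSystem
variable {X : Scheme.{u}} {P : ∀ {Z : Scheme.{u}}, (Z ⟶ X) → Prop} (C : ChartSystem X P)

lemma exists_s (i j : C.J) :
    ∃ s : (C.O (C.τ i) j).toScheme ⟶ C.T j, s ≫ C.τ j = (C.O (C.τ i) j).ι ≫ C.τ i := by
  apply C.lift _ _ (C.P_open _ _ (C.P_τ i))
  rw [C.O_comp _ _ _ (C.P_τ i) (C.P_open _ _ (C.P_τ i))]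
  simp

noncomputable def s (i j : C.J) := (C.exists_s i j).choose
lemma s_τ (i j : C.J) : C.s i j ≫ C.τ j = (C.O (C.τ i) j).ι ≫ C.τ i := (C.exists_s i j).choose_spec

/-- lift into the overlap -/
lemma exists_lift {Z : Scheme.{u}} (i j : C.J) (g : Z ⟶ C.T i) (hg : P (g ≫ C.τ i))
    (h : C.O (g ≫ C.τ i) j = ⊤) :
    ∃ g' : Z ⟶ (C.O (C.τ i) j).toScheme, g' ≫ (C.O (C.τ i) j).ι = g := by
  rw [C.O_comp _ _ _ (C.P_τ i) hg] at h
  refine ⟨IsOpenImmersion.lift (C.O (C.τ i) j).ι g ?_, IsOpenImmersion.lift_fac _ _ _⟩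
  rintro _ ⟨z, rfl⟩
  have : z ∈ g ⁻¹ᵁ C.O (C.τ i) j := by rw [h]; trivial
  simpa using this

lemma O_self {Z : Scheme.{u}} (i : C.J) (g : Z ⟶ C.T i) (hg : P (g ≫ C.τ i)) :
    C.O (g ≫ C.τ i) i = ⊤ := by
  rw [C.O_comp _ _ _ (C.P_τ i) hg, C.O_τ]; rfl

lemma P_V (i j : C.J) : P ((C.O (C.τ i) j).ι ≫ C.τ i) := C.P_open _ _ (C.P_τ i)

lemma exists_t (i j : C.J) :
    ∃ t : (C.O (C.τ i) j).toScheme ⟶ (C.O (C.τ j) i).toScheme,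
      t ≫ (C.O (C.τ j) i).ι = C.s i j := by
  apply C.exists_lift
  · rw [s_τ]; exact C.P_V i j
  · rw [s_τ]; exact C.O_self i _ (C.P_V i j)

noncomputable def t (i j : C.J) := (C.exists_t i j).choose
lemma t_ι (i j : C.J) : C.t i j ≫ (C.O (C.τ j) i).ι = C.s i j := (C.exists_t i j).choose_spec
lemma t_τ (i j : C.J) : C.t i j ≫ (C.O (C.τ j) i).ι ≫ C.τ j = (C.O (C.τ i) j).ι ≫ C.τ i := by
  rw [← Category.assoc, t_ι, s_τ]

lemma hom_ext {Z : Scheme.{u}} (i j : C.J) (g h : Z ⟶ (C.O (C.τ i) j).toScheme)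
    (hP : P (g ≫ (C.O (C.τ i) j).ι ≫ C.τ i))
    (e : g ≫ (C.O (C.τ i) j).ι ≫ C.τ i = h ≫ (C.O (C.τ i) j).ι ≫ C.τ i) : g = h := by
  rw [← cancel_mono (C.O (C.τ i) j).ι]
  apply C.uniq
  · simpa using hP
  · simpa using e

noncomputable abbrev W (i j k : C.J) := pullback (C.O (C.τ i) j).ι (C.O (C.τ i) k).ι

lemma P_W (i j k : C.J) : P ((pullback.fst _ _ : C.W i j k ⟶ _) ≫ (C.O (C.τ i) j).ι ≫ C.τ i) :=
  C.P_open _ _ (C.P_V i j)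

lemma exists_t' (i j k : C.J) :
    ∃ t' : C.W i j k ⟶ C.W j k i, t' ≫ pullback.snd _ _ = pullback.fst _ _ ≫ C.t i j := by
  have e : ((pullback.fst _ _ : C.W i j k ⟶ _) ≫ C.s i j) ≫ C.τ j =
      (pullback.fst _ _ : C.W i j k ⟶ _) ≫ (C.O (C.τ i) j).ι ≫ C.τ i := by
    rw [Category.assoc, s_τ]
  obtain ⟨g, hg⟩ := C.exists_lift j k ((pullback.fst _ _ : C.W i j k ⟶ _) ≫ C.s i j)
    (by rw [e]; exact C.P_W i j k) (by
      rw [e]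
      have : (pullback.fst _ _ : C.W i j k ⟶ _) ≫ (C.O (C.τ i) j).ι ≫ C.τ i =
        ((pullback.snd _ _ : C.W i j k ⟶ _) ≫ (C.O (C.τ i) k).ι) ≫ C.τ i := by
        rw [← pullback.condition, Category.assoc]
      rw [this, C.O_comp _ _ _ (C.P_τ i) (by rw [← this]; exact C.P_W i j k)]
      refine top_le_iff.mp fun w _ => ?_
      simp)
  refine ⟨pullback.lift g (pullback.fst _ _ ≫ C.t i j) ?_, pullback.lift_snd _ _ _⟩
  rw [hg, Category.assoc, t_ι]

noncomputable def t' (i j k : C.J) := (C.exists_t' i j k).choose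
lemma t'_snd (i j k : C.J) : C.t' i j k ≫ pullback.snd _ _ = pullback.fst _ _ ≫ C.t i j :=
  (C.exists_t' i j k).choose_spec

lemma t'_τ (i j k : C.J) :
    C.t' i j k ≫ pullback.fst _ _ ≫ (C.O (C.τ j) k).ι ≫ C.τ j =
      pullback.fst _ _ ≫ (C.O (C.τ i) j).ι ≫ C.τ i := by
  have := C.t'_snd i j k
  rw [pullback.condition_assoc, ← Category.assoc, this, Category.assoc, t_τ]

lemma W_ext {Z : Scheme.{u}} (i j k : C.J) (g h : Z ⟶ C.W i j k)
    (hP : P (g ≫ pullback.fst _ _ ≫ (C.O (C.τ i) j).ι ≫ C.τ i))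
    (e : g ≫ pullback.fst _ _ ≫ (C.O (C.τ i) j).ι ≫ C.τ i =
      h ≫ pullback.fst _ _ ≫ (C.O (C.τ i) j).ι ≫ C.τ i) : g = h := by
  rw [← cancel_mono (pullback.fst _ _)]
  apply C.hom_ext
  · simpa using hP
  · simpa using e

noncomputable def glueData : Scheme.GlueData.{u} where
  J := C.J
  U := C.T
  V ij := (C.O (C.τ ij.1) ij.2).toScheme
  f i j := (C.O (C.τ i) j).ι
  f_id i := by
    have e : (C.O (C.τ i) i).ι = (Scheme.isoOfEq _ (C.O_τ i)).hom ≫ (Scheme.topIso _).hom := by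
      simp
    rw [e]; infer_instance
  t := C.t
  t_id i := C.hom_ext _ _ _ _ (by rw [t_τ]; exact C.P_V i i) (by rw [t_τ]; simp)
  t' := C.t'
  t_fac := C.t'_snd
  cocycle i j k := by
    have e : (C.t' i j k ≫ C.t' j k i ≫ C.t' k i j) ≫ pullback.fst _ _ ≫
        (C.O (C.τ i) j).ι ≫ C.τ i = pullback.fst _ _ ≫ (C.O (C.τ i) j).ι ≫ C.τ i := by
      simp only [Category.assoc, t'_τ]
    apply C.W_ext
    · rw [e]; exact C.P_W i j k
    · rw [e, Category.id_comp]
  f_open i j := inferInstance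

lemma exists_glued (C : ChartSystem X P) : ∃ (G : Scheme.{u}) (κ : ∀ i, C.T i ⟶ G) (π : G ⟶ X),
    (∀ i, IsOpenImmersion (κ i)) ∧ (∀ i, κ i ≫ π = C.τ i) ∧ P π ∧
    (∀ x : G, ∃ i a, κ i a = x) ∧
    (∀ i j, C.t i j ≫ (C.O (C.τ j) i).ι ≫ κ j = (C.O (C.τ i) j).ι ≫ κ i) := by
  have hc : ∀ i j, (C.O (C.τ i) j).ι ≫ C.τ i = (C.t i j ≫ (C.O (C.τ j) i).ι) ≫ C.τ j :=
    fun i j => ((C.t_τ i j).symm.trans (Category.assoc _ _ _).symm)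
  let π : C.glueData.glued ⟶ X := Multicoequalizer.desc _ _ C.τ (fun ij => hc ij.1 ij.2)
  have hπ : ∀ i, C.glueData.ι i ≫ π = C.τ i := fun i => Multicoequalizer.π_desc _ _ _ _ _
  refine ⟨C.glueData.glued, C.glueData.ι, π, fun i => ?_, hπ, ?_,
    C.glueData.ι_jointly_surjective, C.glueData.glue_condition⟩
  · exact C.glueData.openCover.map_prop i
  · refine C.P_local _ C.glueData.openCover fun i => ?_
    have : C.glueData.openCover.f i ≫ π = C.τ i := hπ i
    exact this.symm ▸ C.P_τ i

theorem exists_terminal (C : ChartSystem X P) : ∃ (X' : Scheme.{u}) (π : X' ⟶ X), P π ∧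
    ∀ {Z : Scheme.{u}} (f : Z ⟶ X), P f → ∃! g : Z ⟶ X', g ≫ π = f := by
  obtain ⟨G, κ, π, hκ, hπ, hPπ, hsurj, hglue⟩ := C.exists_glued
  refine ⟨_, π, hPπ, ?_⟩
  have key : ∀ {Z : Scheme.{u}} (i j : C.J) (g : Z ⟶ C.T i) (h : Z ⟶ C.T j), P (g ≫ C.τ i) →
      g ≫ C.τ i = h ≫ C.τ j → g ≫ κ i = h ≫ κ j := by
    intro Z i j g h hP e
    obtain ⟨g', hg'⟩ := C.exists_lift i j g hP (by rw [e]; exact C.O_self j h (e ▸ hP))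
    have hh : (g' ≫ C.t i j) ≫ (C.O (C.τ j) i).ι = h := by
      have : ((g' ≫ C.t i j) ≫ (C.O (C.τ j) i).ι) ≫ C.τ j = g ≫ C.τ i := by
        rw [Category.assoc, Category.assoc, t_τ, ← Category.assoc, hg']
      apply C.uniq
      · rw [this]; exact hP
      · rw [this, e]
    rw [← hg', ← hh]
    simp only [Category.assoc, hglue]
  intro Z f hf
  refine existsUnique_of_exists_of_unique ?_ ?_
  · choose idx hidx using C.O_cover f hf
    have hl : ∀ z : Z, ∃ g : (C.O f (idx z)).toScheme ⟶ C.T (idx z),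
        g ≫ C.τ (idx z) = (C.O f (idx z)).ι ≫ f := fun z => by
      apply C.lift _ _ (C.P_open _ _ hf)
      rw [C.O_comp _ _ _ hf (C.P_open _ _ hf)]
      simp
    choose l hl using hl
    obtain ⟨g, hg⟩ := exists_glue (fun z => C.O f (idx z)) hidx (fun z => l z ≫ κ (idx z)) (by
      intro x y
      rw [← Category.assoc, ← Category.assoc]
      have e : (pullback.fst (C.O f (idx x)).ι (C.O f (idx y)).ι ≫ l x) ≫ C.τ (idx x) =
          (pullback.snd (C.O f (idx x)).ι (C.O f (idx y)).ι ≫ l y) ≫ C.τ (idx y) := by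
        rw [Category.assoc, Category.assoc, hl, hl]
        exact pullback.condition_assoc f
      apply key _ _ _ _ _ e
      rw [Category.assoc, hl]
      exact C.P_open _ _ (C.P_open (Scheme.Opens.ι _) _ hf))
    refine ⟨g, hom_ext_of_mem _ hidx _ _ fun z => ?_⟩
    rw [← Category.assoc, hg, Category.assoc, hπ, hl]
  · intro g h hg hh
    have loc : ∀ z : Z, ∃ (W : Z.Opens) (_ : z ∈ W), W.ι ≫ g = W.ι ≫ h := by
      intro z
      obtain ⟨i, a, ha⟩ := hsurj (g z)
      obtain ⟨j, b, hb⟩ := hsurj (h z)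
      let W : Z.Opens := g ⁻¹ᵁ (κ i).opensRange ⊓ h ⁻¹ᵁ (κ j).opensRange
      refine ⟨W, ⟨⟨a, ha⟩, ⟨b, hb⟩⟩, ?_⟩
      have hg1 : Set.range (W.ι ≫ g) ⊆ Set.range (κ i) := by
        rintro _ ⟨w, rfl⟩; exact w.2.1
      have hh1 : Set.range (W.ι ≫ h) ⊆ Set.range (κ j) := by
        rintro _ ⟨w, rfl⟩; exact w.2.2
      have e1 := IsOpenImmersion.lift_fac (κ i) _ hg1
      have e2 := IsOpenImmersion.lift_fac (κ j) _ hh1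
      rw [← e1, ← e2]
      have e3 : IsOpenImmersion.lift (κ i) _ hg1 ≫ C.τ i = W.ι ≫ f := by
        rw [← hπ, ← Category.assoc, e1, Category.assoc, hg]
      have e4 : IsOpenImmersion.lift (κ j) _ hh1 ≫ C.τ j = W.ι ≫ f := by
        rw [← hπ, ← Category.assoc, e2, Category.assoc, hh]
      exact key _ _ _ _ (by rw [e3]; exact C.P_open _ _ hf) (e3.trans e4.symm)
    choose W hW hWe using loc
    exact hom_ext_of_mem W hW _ _ hWe
end ChartSystem

lemma comap_ideal_top {Z X : Scheme.{u}} [IsAffine Z] [IsAffine X] (g : Z ⟶ X)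
    (I : X.IdealSheafData) :
    (I.comap g).ideal ⟨⊤, isAffineOpen_top Z⟩ =
      (I.ideal ⟨⊤, isAffineOpen_top X⟩).map g.appTop.hom := by
  apply le_antisymm
  · have h : I.comap g ≤ Scheme.IdealSheafData.ofIdealTop
        ((I.ideal ⟨⊤, isAffineOpen_top X⟩).map g.appTop.hom) := by
      rw [← Scheme.IdealSheafData.le_map_iff_comap_le]
      apply Scheme.IdealSheafData.le_of_isAffine
      rw [Scheme.IdealSheafData.ideal_map _ g ⟨⊤, isAffineOpen_top X⟩ (isAffineOpen_top Z)]
      rw [← Ideal.map_le_iff_le_comap]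
      simp
      exact le_refl (Ideal.map g.appTop.hom (I.ideal ⟨⊤, isAffineOpen_top X⟩))
    simpa using h ⟨⊤, isAffineOpen_top Z⟩
  · rw [Ideal.map_le_iff_le_comap]
    have h := Scheme.IdealSheafData.le_map_comap I g ⟨⊤, isAffineOpen_top X⟩
    rwa [Scheme.IdealSheafData.ideal_map _ g ⟨⊤, isAffineOpen_top X⟩ (isAffineOpen_top Z)] at h

lemma isAffineOpen_image_top {Z X : Scheme.{u}} [IsAffine Z] (j : Z ⟶ X) [IsOpenImmersion j] :
    IsAffineOpen (j ''ᵁ ⊤) := (isAffineOpen_top Z).image_of_isOpenImmersion j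

lemma isIso_appLE_open {Z X : Scheme.{u}} (j : Z ⟶ X) [IsOpenImmersion j]
    (U : X.Opens) (hU : j ''ᵁ ⊤ = U) (e : ⊤ ≤ j ⁻¹ᵁ U) : IsIso (j.appLE U ⊤ e) := by
  subst hU
  have e1 : (j.appLE (j ''ᵁ ⊤) ⊤ e) = (j.appIso ⊤).hom := (Scheme.Hom.appIso_hom' j ⊤).symm
  rw [e1]; infer_instance

lemma comap_ideal_open {Z X : Scheme.{u}} [IsAffine Z] (j : Z ⟶ X) [IsOpenImmersion j]
    (I : X.IdealSheafData) (U : X.Opens) (hUa : IsAffineOpen U) (hU : j ''ᵁ ⊤ = U)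
    (e : ⊤ ≤ j ⁻¹ᵁ U) :
    (I.comap j).ideal ⟨⊤, isAffineOpen_top Z⟩ = (I.ideal ⟨U, hUa⟩).map (j.appLE U ⊤ e).hom := by
  subst hU
  rw [Scheme.IdealSheafData.ideal_comap_of_isOpenImmersion]
  have e1 : (j.appLE (j ''ᵁ ⊤) ⊤ e) = (j.appIso ⊤).hom := (Scheme.Hom.appIso_hom' j ⊤).symm
  rw [e1]
  apply le_antisymm
  · intro x hx
    have h := Ideal.mem_map_of_mem (j.appIso ⊤).hom.hom (Ideal.mem_comap.mp hx)
    have e2 : (j.appIso ⊤).hom.hom ((j.appIso ⊤).inv.hom x) = x := by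
      rw [← CommRingCat.comp_apply, Iso.inv_hom_id]; rfl
    rwa [e2] at h
  · rw [Ideal.map_le_iff_le_comap]
    intro y hy
    have e2 : (j.appIso ⊤).inv.hom ((j.appIso ⊤).hom.hom y) = y := by
      rw [← CommRingCat.comp_apply, Iso.hom_inv_id]; rfl
    rw [Ideal.mem_comap, Ideal.mem_comap, e2]
    exact hy

lemma comap_ideal {Z X : Scheme.{u}} (f : Z ⟶ X) (I : X.IdealSheafData) (U : X.affineOpens)
    (W : Z.affineOpens) (e : W.1 ≤ f ⁻¹ᵁ U.1) :
    (I.comap f).ideal W = (I.ideal U).map (f.appLE U.1 W.1 e).hom := by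
  have : IsAffine W.1.toScheme := W.2
  have : IsAffine U.1.toScheme := U.2
  have h1 : (I.comap f).comap W.1.ι = (I.comap U.1.ι).comap (f.resLE U.1 W.1 e) := by
    rw [← Scheme.IdealSheafData.comap_comp, ← Scheme.IdealSheafData.comap_comp]
    simp
  have h2 := congrArg (fun J => J.ideal ⟨⊤, isAffineOpen_top _⟩) h1
  simp only [] at h2
  rw [comap_ideal_open W.1.ι _ W.1 W.2 (by simp) (by simp), comap_ideal_top,
    comap_ideal_open U.1.ι _ U.1 U.2 (by simp) (by simp), Ideal.map_map, ← CommRingCat.hom_comp] at h2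
  have hb : Function.Bijective (W.1.ι.appLE W.1 ⊤ (by simp)).hom := by
    have e2 : IsIso (W.1.ι.appLE W.1 ⊤ (by simp)) := isIso_appLE_open _ _ (by simp) _
    exact ConcreteCategory.bijective_of_isIso _
  have hi : Function.Injective (Ideal.map (W.1.ι.appLE W.1 ⊤ (by simp)).hom) := fun a b h => by
    have := congrArg (Ideal.comap (W.1.ι.appLE W.1 ⊤ (by simp)).hom) h
    rwa [Ideal.comap_map_of_bijective _ hb, Ideal.comap_map_of_bijective _ hb] at this
  apply hi
  refine h2.trans ?_
  rw [Ideal.map_map, ← CommRingCat.hom_comp]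
  congr 2
  have e4 := Scheme.Hom.appLE_comp_appLE (f.resLE U.1 W.1 e) U.1.ι U.1 ⊤ ⊤ (by simp) le_top
  have e3 : (f.resLE U.1 W.1 e).appTop = (f.resLE U.1 W.1 e).appLE ⊤ ⊤ le_top :=
    Scheme.Hom.app_eq_appLE _
  have e5 := Scheme.Hom.appLE_comp_appLE W.1.ι f U.1 W.1 ⊤ e (by simp)
  refine (congrArg (fun t => U.1.ι.appLE U.1 ⊤ (by simp) ≫ t) e3).trans (e4.trans ?_)
  refine Eq.trans ?_ e5.symm
  simp only [Scheme.Hom.resLE_comp_ι]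

/-- The ideal sheaf `I` is invertible, that is, the ideal sheaf of an effective Cartier divisor:
every point has an affine open neighbourhood on which `I` is generated by one nonzerodivisor. -/
def IsInvertible {X : Scheme.{u}} (I : X.IdealSheafData) : Prop :=
  ∀ x : X, ∃ U : X.affineOpens, x ∈ U.1 ∧
    ∃ g ∈ nonZeroDivisors Γ(X, U.1), I.ideal U = Ideal.span {g}

lemma nzd_map_of_flat {A B : Type u} [CommRing A] [CommRing B] (φ : A →+* B) (hφ : φ.Flat)
    {a : A} (ha : a ∈ nonZeroDivisors A) : φ a ∈ nonZeroDivisors B := by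
  algebraize [φ]
  have h := Module.Flat.isSMulRegular_of_nonZeroDivisors (M := B) ha
  rw [mem_nonZeroDivisors_iff_right]
  intro b hb
  apply h
  simp only [smul_zero]
  rw [Algebra.smul_def, mul_comm]; exact hb

lemma nzd_appLE {Z X : Scheme.{u}} (j : Z ⟶ X) [IsOpenImmersion j] {U : X.Opens} {W : Z.Opens}
    (hU : IsAffineOpen U) (hW : IsAffineOpen W) (e : W ≤ j ⁻¹ᵁ U) {a : Γ(X, U)}
    (ha : a ∈ nonZeroDivisors Γ(X, U)) : (j.appLE U W e).hom a ∈ nonZeroDivisors Γ(Z, W) :=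
  nzd_map_of_flat _ (j.flat_appLE hU hW e) ha

lemma IsInvertible.comap_open {Z X : Scheme.{u}} (j : Z ⟶ X) [IsOpenImmersion j]
    {I : X.IdealSheafData} (hI : IsInvertible I) (z : Z) (O : Z.Opens) (hz : z ∈ O) :
    ∃ W : Z.affineOpens, z ∈ W.1 ∧ W.1 ≤ O ∧
      ∃ g ∈ nonZeroDivisors Γ(Z, W.1), (I.comap j).ideal W = Ideal.span {g} := by
  obtain ⟨U, hU, g, hg, hIg⟩ := hI (j z)
  obtain ⟨W, hW, hzW, hWU⟩ := exists_isAffineOpen_mem_and_subset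
    (x := z) (U := O ⊓ j ⁻¹ᵁ U.1) ⟨hz, hU⟩
  refine ⟨⟨W, hW⟩, hzW, fun w hw => (hWU hw).1, _,
    nzd_appLE j U.2 hW (fun w hw => (hWU hw).2) hg, ?_⟩
  rw [comap_ideal j I U ⟨W, hW⟩ (fun w hw => (hWU hw).2), hIg, Ideal.map_span, Set.image_singleton]

lemma IsInvertible.shrink {X : Scheme.{u}} {I : X.IdealSheafData} (hI : IsInvertible I)
    (x : X) (O : X.Opens) (hx : x ∈ O) :
    ∃ W : X.affineOpens, x ∈ W.1 ∧ W.1 ≤ O ∧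
      ∃ g ∈ nonZeroDivisors Γ(X, W.1), I.ideal W = Ideal.span {g} := by
  simpa using hI.comap_open (𝟙 X) x O hx

lemma IsInvertible.of_cover {Z : Scheme.{u}} (J : Z.IdealSheafData) (𝒰 : Scheme.OpenCover.{u} Z)
    (h : ∀ i, IsInvertible (J.comap (𝒰.f i))) : IsInvertible J := by
  intro z
  obtain ⟨i, w, rfl⟩ := 𝒰.exists_eq z
  obtain ⟨W, hwW, g, hg, hJ⟩ := h i w
  refine ⟨⟨(𝒰.f i) ''ᵁ W.1, W.2.image_of_isOpenImmersion _⟩, ⟨w, hwW, rfl⟩, ?_⟩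
  rw [Scheme.IdealSheafData.ideal_comap_of_isOpenImmersion] at hJ
  let e := ((𝒰.f i).appIso W.1).commRingCatIsoToRingEquiv
  refine ⟨e.symm g, ?_, ?_⟩
  · rw [mem_nonZeroDivisors_iff_right] at hg ⊢
    intro x hx
    apply e.injective
    rw [map_zero]
    apply hg
    have := congrArg e hx
    simpa using this
  · have h2 : Ideal.comap e.symm (J.ideal ⟨(𝒰.f i) ''ᵁ W.1, W.2.image_of_isOpenImmersion _⟩) =
      Ideal.span {g} := hJ
    have h3 := congrArg (Ideal.map e.symm) h2
    rw [Ideal.map_comap_of_surjective _ e.symm.surjective, Ideal.map_span, Set.image_singleton] at h3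
    exact h3

section ring
variable {A : Type u} [CommRing A] (I : Ideal A) (a : A)

/-- affine blow-up algebra `A[I/a]`. -/
def ChartRing : Subalgebra A (Localization.Away a) :=
  Algebra.adjoin A {r | ∃ x ∈ I, r * algebraMap A (Localization.Away a) a =
    algebraMap A (Localization.Away a) x}

lemma nzd_of_isUnit {B : Type u} [CommRing B] [Algebra A B] (S : Subalgebra A B)
    (h : IsUnit (algebraMap A B a)) : algebraMap A S a ∈ nonZeroDivisors S := by
  rw [mem_nonZeroDivisors_iff_right]
  intro x hx
  have := congrArg Subtype.val hx
  apply Subtype.ext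
  exact (h.mul_left_eq_zero).mp this

lemma chart_nzd : algebraMap A (ChartRing I a) a ∈ nonZeroDivisors (ChartRing I a) :=
  nzd_of_isUnit _ _ (IsLocalization.Away.algebraMap_isUnit a)

lemma chart_ideal (ha : a ∈ I) :
    I.map (algebraMap A (ChartRing I a)) = Ideal.span {algebraMap A (ChartRing I a) a} := by
  apply le_antisymm
  · rw [Ideal.map_le_iff_le_comap]
    intro x hx
    rw [Ideal.mem_comap, Ideal.mem_span_singleton']
    have hu := IsLocalization.Away.algebraMap_isUnit (S := Localization.Away a) a
    obtain ⟨u, hu⟩ := hu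
    let r : Localization.Away a := algebraMap A _ x * ↑u⁻¹
    have hr : r * algebraMap A (Localization.Away a) a = algebraMap A _ x := by
      simp [r, ← hu]
    exact ⟨⟨r, Algebra.subset_adjoin ⟨x, hx, hr⟩⟩, Subtype.ext hr⟩
  · rw [Ideal.span_le, Set.singleton_subset_iff]
    exact Ideal.mem_map_of_mem _ ha

variable {I a} {B : Type u} [CommRing B] (φ : A →+* B)

lemma chart_den (r : ChartRing I a) : ∃ (n : ℕ) (x : A),
    r * algebraMap A (ChartRing I a) a ^ n = algebraMap A (ChartRing I a) x := by
  obtain ⟨⟨x, ⟨_, n, rfl⟩⟩, h⟩ := IsLocalization.surj (M := Submonoid.powers a) r.1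
  refine ⟨n, x, Subtype.ext ?_⟩
  simpa using h

lemma chart_uniq (ψ₁ ψ₂ : ChartRing I a →+* B)
    (h : ψ₁.comp (algebraMap A _) = ψ₂.comp (algebraMap A _))
    (ha : ψ₁ (algebraMap A _ a) ∈ nonZeroDivisors B) : ψ₁ = ψ₂ := by
  ext r
  obtain ⟨n, x, hx⟩ := chart_den r
  have h1 := congrArg ψ₁ hx
  have h2 := congrArg ψ₂ hx
  have h3 : ∀ y, ψ₁ (algebraMap A _ y) = ψ₂ (algebraMap A _ y) := fun y => RingHom.congr_fun h y
  rw [map_mul, map_pow] at h1 h2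
  rw [← h3, ← h3, ← h1] at h2
  exact ((mul_cancel_right_mem_nonZeroDivisors (pow_mem ha n)).mp h2).symm

lemma chart_lift (hφ : I.map φ = Ideal.span {φ a}) (ha : φ a ∈ nonZeroDivisors B) :
    ∃ ψ : ChartRing I a →+* B, ψ.comp (algebraMap A _) = φ := by
  let L := Localization.Away (φ a)
  have hinj : Function.Injective (algebraMap B L) :=
    IsLocalization.injective L (Submonoid.powers_le.mpr ha)
  let Φ : Localization.Away a →+* L := IsLocalization.Away.lift (g := (algebraMap B L).comp φ) a
    (by simpa using IsLocalization.Away.algebraMap_isUnit (S := L) (φ a))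
  have hΦ : ∀ y, Φ (algebraMap A _ y) = algebraMap B L (φ y) := fun y =>
    IsLocalization.Away.lift_eq _ _ y
  have hmem : ∀ r : ChartRing I a, ∃ b, algebraMap B L b = Φ r.1 := by
    rintro ⟨r, hr⟩
    induction hr using Algebra.adjoin_induction with
    | mem r hr =>
      obtain ⟨x, hx, hr⟩ := hr
      have : φ x ∈ Ideal.span {φ a} := hφ ▸ Ideal.mem_map_of_mem φ hx
      obtain ⟨b, hb⟩ := Ideal.mem_span_singleton'.mp this
      refine ⟨b, ?_⟩
      have h1 := congrArg Φ hr
      rw [map_mul, hΦ, hΦ, ← hb, map_mul] at h1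
      exact ((IsLocalization.Away.algebraMap_isUnit (S := L) (φ a)).mul_left_injective h1).symm
    | algebraMap y => exact ⟨φ y, (hΦ y).symm⟩
    | add x y _ _ hx hy =>
      obtain ⟨b, hb⟩ := hx; obtain ⟨c, hc⟩ := hy
      exact ⟨b + c, by simp [hb, hc]⟩
    | mul x y _ _ hx hy =>
      obtain ⟨b, hb⟩ := hx; obtain ⟨c, hc⟩ := hy
      exact ⟨b * c, by simp [hb, hc]⟩
  choose ψ hψ using hmem
  refine ⟨{ toFun := ψ, map_one' := hinj (by simp [hψ]), map_zero' := hinj (by simp [hψ]),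
            map_add' := fun x y => hinj (by simp [hψ]),
            map_mul' := fun x y => hinj (by simp [hψ]) }, ?_⟩
  ext y
  exact hinj ((hψ _).trans (hΦ y))

lemma exists_unit_coeff {n : B} (hn : n ∈ nonZeroDivisors B) (hI : I.map φ = Ideal.span {n}) :
    Ideal.span {c : B | ∃ x ∈ I, φ x = n * c} = ⊤ := by
  have h1 : I.map φ ≤ Ideal.span {n} * Ideal.span {c : B | ∃ x ∈ I, φ x = n * c} := by
    rw [Ideal.map_le_iff_le_comap]
    intro x hx
    have : φ x ∈ Ideal.span {n} := hI ▸ Ideal.mem_map_of_mem φ hx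
    obtain ⟨c, hc⟩ := Ideal.mem_span_singleton.mp this
    rw [Ideal.mem_comap, hc]
    exact Ideal.mul_mem_mul (Ideal.mem_span_singleton_self n) (Ideal.subset_span ⟨x, hx, hc⟩)
  have h2 : n ∈ Ideal.span {n} * Ideal.span {c : B | ∃ x ∈ I, φ x = n * c} :=
    h1 (hI ▸ Ideal.mem_span_singleton_self n)
  obtain ⟨d, hd, e⟩ := Ideal.mem_span_singleton_mul.mp h2
  have : d = 1 := by
    apply (mul_cancel_left_mem_nonZeroDivisors hn).mp
    rw [e, mul_one]
  rw [Ideal.eq_top_iff_one, ← this]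
  exact hd
end ring

section chart
variable {X : Scheme.{u}} (I : X.IdealSheafData)

noncomputable abbrev chart (U : X.affineOpens) (a : Γ(X, U.1)) : Scheme.{u} :=
  Spec (.of (ChartRing (I.ideal U) a))

noncomputable def chartToBase (U : X.affineOpens) (a : Γ(X, U.1)) : chart I U a ⟶ X :=
  Spec.map (CommRingCat.ofHom (algebraMap Γ(X, U.1) (ChartRing (I.ideal U) a))) ≫ U.2.fromSpec

/-- locus where `a` generates -/
def genLocus {Z : Scheme.{u}} (f : Z ⟶ X) (U : X.affineOpens) (a : Γ(X, U.1)) : Z.Opens :=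
  sSup {W | ∃ (hW : IsAffineOpen W) (e : W ≤ f ⁻¹ᵁ U.1),
    (I.comap f).ideal ⟨W, hW⟩ = Ideal.span {f.appLE U.1 W e a}}

lemma mem_genLocus {Z : Scheme.{u}} (f : Z ⟶ X) (U : X.affineOpens) (a : Γ(X, U.1)) (z : Z) :
    z ∈ genLocus I f U a ↔ ∃ (W : Z.Opens) (_ : z ∈ W) (hW : IsAffineOpen W)
      (e : W ≤ f ⁻¹ᵁ U.1), (I.comap f).ideal ⟨W, hW⟩ = Ideal.span {f.appLE U.1 W e a} := by
  rw [genLocus, TopologicalSpace.Opens.mem_sSup]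
  constructor
  · rintro ⟨W, ⟨hW, e, h⟩, hz⟩; exact ⟨W, hz, hW, e, h⟩
  · rintro ⟨W, hz, hW, e, h⟩; exact ⟨W, ⟨hW, e, h⟩, hz⟩

lemma appLE_gen_of_comp {W Z : Scheme.{u}} (g : W ⟶ Z) (f : Z ⟶ X) (U : X.affineOpens)
    (a : Γ(X, U.1)) {V : Z.Opens} (hV : IsAffineOpen V) (e : V ≤ f ⁻¹ᵁ U.1)
    (h : (I.comap f).ideal ⟨V, hV⟩ = Ideal.span {f.appLE U.1 V e a})
    {V' : W.Opens} (hV' : IsAffineOpen V') (e' : V' ≤ g ⁻¹ᵁ V) (e'' : V' ≤ (g ≫ f) ⁻¹ᵁ U.1) :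
    (I.comap (g ≫ f)).ideal ⟨V', hV'⟩ = Ideal.span {(g ≫ f).appLE U.1 V' e'' a} := by
  rw [Scheme.IdealSheafData.comap_comp, comap_ideal g (I.comap f) ⟨V, hV⟩ ⟨V', hV'⟩ e', h,
    Ideal.map_span, Set.image_singleton]
  have := Scheme.Hom.appLE_comp_appLE g f U.1 V V' e e'
  rw [← this]; rfl

/-- restriction of a generator to a smaller affine open -/
lemma appLE_gen_restrict {Z : Scheme.{u}} (f : Z ⟶ X) (U : X.affineOpens)
    (a : Γ(X, U.1)) {V : Z.Opens} (hV : IsAffineOpen V) (e : V ≤ f ⁻¹ᵁ U.1)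
    (h : (I.comap f).ideal ⟨V, hV⟩ = Ideal.span {f.appLE U.1 V e a})
    {V' : Z.Opens} (hV' : IsAffineOpen V') (e' : V' ≤ V) :
    (I.comap f).ideal ⟨V', hV'⟩ = Ideal.span {f.appLE U.1 V' (e'.trans e) a} := by
  have := appLE_gen_of_comp I (𝟙 Z) f U a hV e h hV' (by simpa using e') (by simpa using e'.trans e)
  simpa using this

/-- a generator of an ideal generated by a nonzerodivisor is a nonzerodivisor -/
lemma nzd_of_span_eq {B : Type u} [CommRing B] {n m : B} (hn : n ∈ nonZeroDivisors B)
    (h : Ideal.span {n} = Ideal.span {m}) : m ∈ nonZeroDivisors B := by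
  obtain ⟨u, hu⟩ := Ideal.mem_span_singleton.mp (h ▸ Ideal.mem_span_singleton_self n)
  rw [hu] at hn
  exact (mul_mem_nonZeroDivisors.mp hn).1

lemma exists_nzd_gen {Z : Scheme.{u}} (f : Z ⟶ X) (hf : IsInvertible (I.comap f))
    (U : X.affineOpens) (a : Γ(X, U.1)) (z : Z) (hz : z ∈ genLocus I f U a) :
    ∃ (W : Z.Opens) (_ : z ∈ W) (hW : IsAffineOpen W) (e : W ≤ f ⁻¹ᵁ U.1),
      (I.comap f).ideal ⟨W, hW⟩ = Ideal.span {f.appLE U.1 W e a} ∧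
      f.appLE U.1 W e a ∈ nonZeroDivisors Γ(Z, W) := by
  obtain ⟨V, hzV, hV, e, h⟩ := (mem_genLocus I f U a z).mp hz
  obtain ⟨W, hzW, hWV, g, hg, hgW⟩ := hf.shrink z V hzV
  have h2 := appLE_gen_restrict I f U a hV e h W.2 hWV
  exact ⟨W.1, hzW, W.2, hWV.trans e, h2, nzd_of_span_eq hg (hgW.symm.trans h2)⟩

lemma genLocus_comp {W Z : Scheme.{u}} (g : W ⟶ Z) (f : Z ⟶ X) (U : X.affineOpens)
    (a : Γ(X, U.1)) (ha : a ∈ I.ideal U)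
    (hf : IsInvertible (I.comap f)) (hgf : IsInvertible (I.comap (g ≫ f))) :
    genLocus I (g ≫ f) U a = g ⁻¹ᵁ genLocus I f U a := by
  apply le_antisymm
  · intro w hw
    obtain ⟨W', hwW', hW', e', h', -⟩ := exists_nzd_gen I _ hgf U a w hw
    have hzU : g w ∈ f ⁻¹ᵁ U.1 := by simpa using e' hwW'
    obtain ⟨V, hzV, hVU, n, hn, hnV⟩ := hf.shrink (g w) (f ⁻¹ᵁ U.1) hzU
    obtain ⟨W'', hwW'', hW'', m, hm, hmW''⟩ := hgf.shrink w (W' ⊓ g ⁻¹ᵁ V.1) ⟨hwW', hzV⟩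
    have l1 : W''.1 ≤ W' := hW''.trans inf_le_left
    have l2 : W''.1 ≤ g ⁻¹ᵁ V.1 := hW''.trans inf_le_right
    have h2 := appLE_gen_restrict I (g ≫ f) U a hW' e' h' W''.2 l1
    have hac : f.appLE U.1 V.1 hVU a ∈ (I.comap f).ideal V := by
      rw [comap_ideal f I U V hVU]; exact Ideal.mem_map_of_mem _ ha
    rw [hnV] at hac
    obtain ⟨c, hc⟩ := Ideal.mem_span_singleton.mp hac
    have h3 : (I.comap (g ≫ f)).ideal W'' = Ideal.span {g.appLE V.1 W''.1 l2 n} := by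
      rw [Scheme.IdealSheafData.comap_comp, comap_ideal g (I.comap f) V W'' l2, hnV,
        Ideal.map_span, Set.image_singleton]
    have h4 : (g ≫ f).appLE U.1 W''.1 (l1.trans e') a =
        g.appLE V.1 W''.1 l2 n * g.appLE V.1 W''.1 l2 c := by
      rw [← map_mul, ← hc, ← Scheme.Hom.appLE_comp_appLE g f U.1 V.1 W''.1 hVU l2]
      rfl
    have hn' := nzd_of_span_eq hm (hmW''.symm.trans h3)
    have hu : IsUnit (g.appLE V.1 W''.1 l2 c) := by
      have : g.appLE V.1 W''.1 l2 n ∈ Ideal.span {(g ≫ f).appLE U.1 W''.1 (l1.trans e') a} := by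
        rw [← h2]
        change _ ∈ (I.comap (g ≫ f)).ideal W''
        rw [h3]; exact Ideal.mem_span_singleton_self _
      obtain ⟨d, hd⟩ := Ideal.mem_span_singleton.mp this
      rw [h4, mul_assoc] at hd
      have h5 : g.appLE V.1 W''.1 l2 c * d = 1 :=
        (mul_cancel_left_mem_nonZeroDivisors hn').mp (by rw [← hd, mul_one])
      exact IsUnit.of_mul_eq_one _ h5
    have hz : g w ∈ Z.basicOpen c := by
      have : w ∈ W.basicOpen (g.appLE V.1 W''.1 l2 c) := by
        rw [Scheme.basicOpen_of_isUnit _ hu]; exact hwW''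
      rw [Scheme.basicOpen_appLE] at this
      exact this.2
    refine (mem_genLocus I f U a (g w)).mpr
      ⟨Z.basicOpen c, hz, V.2.basicOpen c, (Z.basicOpen_le c).trans hVU, ?_⟩
    have h6 := Scheme.IdealSheafData.map_ideal (I.comap f) (U := ⟨Z.basicOpen c, V.2.basicOpen c⟩)
      (V := V) (Z.basicOpen_le c)
    rw [← h6, hnV, Ideal.map_span, Set.image_singleton]
    have h7 : f.appLE U.1 (Z.basicOpen c) ((Z.basicOpen_le c).trans hVU) a =
        Z.presheaf.map (homOfLE (Z.basicOpen_le c)).op n *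
          Z.presheaf.map (homOfLE (Z.basicOpen_le c)).op c := by
      rw [← map_mul, ← hc, ← Scheme.Hom.appLE_map f hVU (homOfLE (Z.basicOpen_le c)).op]
      rfl
    rw [h7]
    exact (Ideal.span_singleton_mul_right_unit (RingedSpace.isUnit_res_basicOpen _ c) _).symm
  · intro w hw
    obtain ⟨V, hzV, hV, e, h⟩ := (mem_genLocus I f U a (g w)).mp hw
    obtain ⟨W', hW', hwW', hWV⟩ := exists_isAffineOpen_mem_and_subset
      (x := w) (U := g ⁻¹ᵁ V) hzV
    have e'' : W' ≤ (g ≫ f) ⁻¹ᵁ U.1 := fun x hx => by simpa using e (hWV hx)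
    exact (mem_genLocus I _ U a w).mpr ⟨W', hwW', hW', e'',
      appLE_gen_of_comp I g f U a hV e h hW' hWV e''⟩
end chart

section chart
variable {X : Scheme.{u}} (I : X.IdealSheafData)

lemma appLE_specMap_fromSpec {U : X.Opens} (hU : IsAffineOpen U) {B : CommRingCat.{u}}
    (φ : Γ(X, U) ⟶ B) (e : ⊤ ≤ (Spec.map φ ≫ hU.fromSpec) ⁻¹ᵁ U) :
    (Spec.map φ ≫ hU.fromSpec).appLE U ⊤ e = φ ≫ (Scheme.ΓSpecIso B).inv := by
  have h1 := Scheme.Hom.appLE_comp_appLE (Spec.map φ) hU.fromSpec U ⊤ ⊤ (by simp) le_top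
  rw [← h1]
  have h2 : hU.fromSpec.appLE U ⊤ (by simp) = (Scheme.ΓSpecIso Γ(X, U)).inv := by
    rw [Scheme.Hom.appLE, hU.fromSpec_app_self, Category.assoc, ← Functor.map_comp]
    simp
  have h3 : (Spec.map φ).appLE ⊤ ⊤ le_top = (Spec.map φ).appTop := (Scheme.Hom.app_eq_appLE _).symm
  rw [h2, Scheme.ΓSpecIso_inv_naturality]
  exact congrArg (fun t => _ ≫ t) h3

lemma chartToBase_le (U : X.affineOpens) (a : Γ(X, U.1)) : ⊤ ≤ chartToBase I U a ⁻¹ᵁ U.1 := by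
  intro x _
  change (chartToBase I U a) x ∈ U.1
  rw [chartToBase, Scheme.Hom.comp_apply]
  have := Set.mem_range_self (f := U.2.fromSpec)
    (Spec.map (CommRingCat.ofHom (algebraMap Γ(X, U.1) (ChartRing (I.ideal U) a))) x)
  rwa [U.2.range_fromSpec] at this

lemma chart_appLE (U : X.affineOpens) (a b : Γ(X, U.1)) :
    (chartToBase I U a).appLE U.1 ⊤ (chartToBase_le I U a) b =
      (Scheme.ΓSpecIso (.of (ChartRing (I.ideal U) a))).inv
        (algebraMap Γ(X, U.1) (ChartRing (I.ideal U) a) b) := by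
  have := appLE_specMap_fromSpec U.2
    (CommRingCat.ofHom (algebraMap Γ(X, U.1) (ChartRing (I.ideal U) a))) (chartToBase_le I U a)
  exact congrArg (fun t => t.hom b) this

lemma chart_gen (U : X.affineOpens) (a : Γ(X, U.1)) (ha : a ∈ I.ideal U) :
    (I.comap (chartToBase I U a)).ideal ⟨⊤, isAffineOpen_top _⟩ =
      Ideal.span {(chartToBase I U a).appLE U.1 ⊤ (chartToBase_le I U a) a} := by
  rw [comap_ideal _ I U ⟨⊤, isAffineOpen_top _⟩ (chartToBase_le I U a), chart_appLE]
  have h := appLE_specMap_fromSpec U.2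
    (CommRingCat.ofHom (algebraMap Γ(X, U.1) (ChartRing (I.ideal U) a))) (chartToBase_le I U a)
  refine (congrArg (fun t : Γ(X, U.1) ⟶ _ => Ideal.map t.hom (I.ideal U)) h).trans ?_
  have key : ∀ {C : Type u} [CommRing C] (ψ : ChartRing (I.ideal U) a →+* C),
      Ideal.map (ψ.comp (algebraMap Γ(X, U.1) (ChartRing (I.ideal U) a))) (I.ideal U) =
        Ideal.span {ψ (algebraMap Γ(X, U.1) (ChartRing (I.ideal U) a) a)} := fun ψ => by
    rw [← Ideal.map_map, chart_ideal _ _ ha, Ideal.map_span, Set.image_singleton]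
  exact key (Scheme.ΓSpecIso (.of (ChartRing (I.ideal U) a))).inv.hom

lemma chart_isInvertible (U : X.affineOpens) (a : Γ(X, U.1)) (ha : a ∈ I.ideal U) :
    IsInvertible (I.comap (chartToBase I U a)) := by
  intro x
  refine ⟨⟨⊤, isAffineOpen_top _⟩, trivial, _, ?_, chart_gen I U a ha⟩
  rw [chart_appLE]
  let e := (Scheme.ΓSpecIso (.of (ChartRing (I.ideal U) a))).symm.commRingCatIsoToRingEquiv
  exact nzd_map_of_flat e.toRingHom (.of_bijective e.bijective) (chart_nzd _ _)

lemma chart_genLocus (U : X.affineOpens) (a : Γ(X, U.1)) (ha : a ∈ I.ideal U) :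
    genLocus I (chartToBase I U a) U a = ⊤ :=
  top_le_iff.mp fun x _ => (mem_genLocus I _ U a x).mpr
    ⟨⊤, trivial, isAffineOpen_top _, chartToBase_le I U a, chart_gen I U a ha⟩

lemma chart_hom_ext {Z : Scheme.{u}} (U : X.affineOpens) (a : Γ(X, U.1)) (ha : a ∈ I.ideal U)
    (g h : Z ⟶ chart I U a) (hg : IsInvertible (I.comap (g ≫ chartToBase I U a)))
    (e : g ≫ chartToBase I U a = h ≫ chartToBase I U a) : g = h := by
  have hz : ∀ z : Z, z ∈ genLocus I (g ≫ chartToBase I U a) U a := fun z => by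
    rw [genLocus_comp I g _ U a ha (chart_isInvertible I U a ha) hg, chart_genLocus I U a ha]
    trivial
  choose W hzW hW eW h1 h2 using fun z => exists_nzd_gen I _ hg U a z (hz z)
  refine hom_ext_of_mem W hzW g h fun z => ?_
  rw [← (hW z).isoSpec_hom_fromSpec, Category.assoc, Category.assoc]
  congr 1
  obtain ⟨ψ₁, hψ₁⟩ := Spec.map_surjective ((hW z).fromSpec ≫ g)
  obtain ⟨ψ₂, hψ₂⟩ := Spec.map_surjective ((hW z).fromSpec ≫ h)
  rw [← hψ₁, ← hψ₂]
  have k1 : CommRingCat.ofHom (algebraMap Γ(X, U.1) (ChartRing (I.ideal U) a)) ≫ ψ₁ =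
      (g ≫ chartToBase I U a).appLE U.1 (W z) (eW z) := by
    apply Spec.map_injective
    have hU : IsAffineOpen U.1 := U.2
    have : Mono hU.fromSpec := inferInstance
    rw [← cancel_mono hU.fromSpec, Spec.map_comp, hψ₁, IsAffineOpen.SpecMap_appLE_fromSpec _ U.2 (hW z)]
    simp [chartToBase]
  have k2 : CommRingCat.ofHom (algebraMap Γ(X, U.1) (ChartRing (I.ideal U) a)) ≫ ψ₂ =
      (g ≫ chartToBase I U a).appLE U.1 (W z) (eW z) := by
    apply Spec.map_injective
    have hU : IsAffineOpen U.1 := U.2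
    have : Mono hU.fromSpec := inferInstance
    rw [← cancel_mono hU.fromSpec, Spec.map_comp, hψ₂, IsAffineOpen.SpecMap_appLE_fromSpec _ U.2 (hW z),
      e]
    simp [chartToBase]
  have k3 : ψ₁.hom = ψ₂.hom := by
    apply chart_uniq
    · exact congrArg CommRingCat.Hom.hom (k1.trans k2.symm)
    · have := congrArg (fun t => t.hom a) k1
      have h3 := h2 z
      rw [← this] at h3
      exact h3
  rw [CommRingCat.hom_ext k3]

lemma chart_exists_lift {Z : Scheme.{u}} (U : X.affineOpens) (a : Γ(X, U.1)) (ha : a ∈ I.ideal U)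
    (f : Z ⟶ X) (hf : IsInvertible (I.comap f)) (hz : genLocus I f U a = ⊤) :
    ∃ g : Z ⟶ chart I U a, g ≫ chartToBase I U a = f := by
  choose W hzW hW eW h1 h2 using fun z => exists_nzd_gen I _ hf U a z (by rw [hz]; trivial)
  have hl : ∀ z, ∃ g : (W z).toScheme ⟶ chart I U a, g ≫ chartToBase I U a = (W z).ι ≫ f := by
    intro z
    obtain ⟨ψ, hψ⟩ := chart_lift (I := I.ideal U) (a := a) (f.appLE U.1 (W z) (eW z)).hom
      (by rw [← comap_ideal f I U ⟨W z, hW z⟩ (eW z)]; exact h1 z) (h2 z)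
    refine ⟨(hW z).isoSpec.hom ≫ Spec.map (CommRingCat.ofHom ψ), ?_⟩
    rw [chartToBase, Category.assoc, ← Spec.map_comp_assoc, ← CommRingCat.ofHom_comp, hψ]
    have : CommRingCat.ofHom (f.appLE U.1 (W z) (eW z)).hom = f.appLE U.1 (W z) (eW z) := rfl
    rw [this, IsAffineOpen.SpecMap_appLE_fromSpec _ U.2 (hW z), IsAffineOpen.isoSpec_hom_fromSpec_assoc]
  choose l hl using hl
  obtain ⟨g, hg⟩ := exists_glue W hzW l (fun x y => by
    apply chart_hom_ext I U a ha
    · rw [Category.assoc, hl, Scheme.IdealSheafData.comap_comp, Scheme.IdealSheafData.comap_comp]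
      have h := fun z => ((hf.comap_open (W x).ι) z ⊤ trivial)
      have h' : IsInvertible ((I.comap f).comap (W x).ι) := fun z =>
        let ⟨V, hV, _, k⟩ := h z; ⟨V, hV, k⟩
      exact fun z => let ⟨V, hV, _, k⟩ := (h'.comap_open (pullback.fst (W x).ι (W y).ι)) z ⊤ trivial
        ⟨V, hV, k⟩
    · rw [Category.assoc, Category.assoc, hl, hl]
      exact pullback.condition_assoc f)
  refine ⟨g, hom_ext_of_mem W hzW _ _ fun z => ?_⟩
  rw [← Category.assoc, hg, hl]

lemma genLocus_cover {Z : Scheme.{u}} (f : Z ⟶ X) (hf : IsInvertible (I.comap f)) (z : Z) :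
    ∃ (U : X.affineOpens) (a : Γ(X, U.1)), a ∈ I.ideal U ∧ z ∈ genLocus I f U a := by
  obtain ⟨U, hU, hzU, -⟩ := exists_isAffineOpen_mem_and_subset (x := f z) (U := ⊤) trivial
  obtain ⟨W, hzW, hWU, n, hn, hnW⟩ := hf.shrink z (f ⁻¹ᵁ U) hzU
  have h1 := hnW
  rw [comap_ideal f I ⟨U, hU⟩ W hWU] at h1
  have h2 := exists_unit_coeff _ hn h1
  have h3 : ∃ c ∈ {c | ∃ x ∈ I.ideal ⟨U, hU⟩, (f.appLE U W.1 hWU).hom x = n * c},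
      z ∈ Z.basicOpen c := by
    by_contra hcon
    push Not at hcon
    have h4 : Ideal.span {c | ∃ x ∈ I.ideal ⟨U, hU⟩, (f.appLE U W.1 hWU).hom x = n * c} ≤
        (IsLocalRing.maximalIdeal (Z.presheaf.stalk z)).comap (Z.presheaf.germ W.1 z hzW).hom := by
      rw [Ideal.span_le]
      intro c hc
      have := hcon c hc
      rw [Scheme.mem_basicOpen _ _ z hzW] at this
      exact this
    rw [h2, top_le_iff] at h4
    have h5 := (Ideal.eq_top_iff_one _).mp h4
    rw [Ideal.mem_comap, map_one] at h5
    exact (Ideal.ne_top_iff_one _).mp (IsLocalRing.maximalIdeal.isMaximal _).ne_top h5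
  obtain ⟨c, ⟨x, hx, hxc⟩, hzc⟩ := h3
  refine ⟨⟨U, hU⟩, x, hx, (mem_genLocus I f _ x z).mpr
      ⟨Z.basicOpen c, hzc, W.2.basicOpen c, (Z.basicOpen_le c).trans hWU, ?_⟩⟩
  have h6 := Scheme.IdealSheafData.map_ideal (I.comap f) (U := ⟨Z.basicOpen c, W.2.basicOpen c⟩)
    (V := W) (Z.basicOpen_le c)
  rw [← h6, hnW, Ideal.map_span, Set.image_singleton]
  have h7 : f.appLE U (Z.basicOpen c) ((Z.basicOpen_le c).trans hWU) x =
      Z.presheaf.map (homOfLE (Z.basicOpen_le c)).op n *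
        Z.presheaf.map (homOfLE (Z.basicOpen_le c)).op c := by
    rw [← map_mul, ← hxc, ← Scheme.Hom.appLE_map f hWU (homOfLE (Z.basicOpen_le c)).op]
    rfl
  refine Eq.trans ?_ (congrArg (fun t => Ideal.span {t}) h7.symm)
  exact (Ideal.span_singleton_mul_right_unit (RingedSpace.isUnit_res_basicOpen _ c) _).symm

noncomputable def chartSystem : ChartSystem X (fun {_} f => IsInvertible (I.comap f)) where
  J := Σ U : X.affineOpens, I.ideal U
  T i := chart I i.1 i.2.1
  τ i := chartToBase I i.1 i.2.1
  O f i := genLocus I f i.1 i.2.1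
  P_open j _ f hf := by
    rw [Scheme.IdealSheafData.comap_comp]
    exact fun z => let ⟨V, hV, _, k⟩ := (hf.comap_open j) z ⊤ trivial
      ⟨V, hV, k⟩
  P_local f 𝒰 h := IsInvertible.of_cover _ 𝒰 fun i => by
    rw [← Scheme.IdealSheafData.comap_comp]; exact h i
  P_τ i := chart_isInvertible I i.1 i.2.1 i.2.2
  uniq i g h hg e := chart_hom_ext I i.1 i.2.1 i.2.2 g h hg e
  lift f i hf h := chart_exists_lift I i.1 i.2.1 i.2.2 f hf h
  O_comp g f i hf hgf := genLocus_comp I g f i.1 i.2.1 i.2.2 hf hgf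
  O_τ i := chart_genLocus I i.1 i.2.1 i.2.2
  O_cover f hf z := by
    obtain ⟨U, a, ha, h⟩ := genLocus_cover I f hf z
    exact ⟨⟨U, a, ha⟩, h⟩

/-- Existence of the blow-up of `X` along `I`: the inverse image ideal sheaf of `I` on it is
invertible, and it is terminal among the schemes over `X` with this property. -/
theorem exists_blowup : ∃ (X' : Scheme.{u}) (π : X' ⟶ X), IsInvertible (I.comap π) ∧
    ∀ {Z : Scheme.{u}} (f : Z ⟶ X), IsInvertible (I.comap f) → ∃! g : Z ⟶ X', g ≫ π = f :=
  (chartSystem I).exists_terminal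
end chart
end BlowupAux

namespace BinomialBlowup

open BlowupAux

variable {X : Scheme.{u}}

/-- The blow-up of the scheme `X` along the ideal sheaf `I`. -/
noncomputable def blowUp (I : X.IdealSheafData) : Scheme.{u} :=
  (exists_blowup I).choose

/-- The structure morphism of the blow-up. -/
noncomputable def blowUpMap (I : X.IdealSheafData) : blowUp I ⟶ X :=
  (exists_blowup I).choose_spec.choose

theorem isInvertible_comap_blowUpMap (I : X.IdealSheafData) :
    IsInvertible (I.comap (blowUpMap I)) :=
  (exists_blowup I).choose_spec.choose_spec.1

theorem blowUp_existsUnique_lift (I : X.IdealSheafData) {Z : Scheme.{u}} (f : Z ⟶ X)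
    (hf : IsInvertible (I.comap f)) : ∃! g : Z ⟶ blowUp I, g ≫ blowUpMap I = f :=
  (exists_blowup I).choose_spec.choose_spec.2 f hf

/-- The proper transform, on the blow-up along `I`, of the divisor with ideal sheaf `D ≤ I`:
the ideal quotient of the inverse image of `D` by the ideal sheaf of the exceptional divisor.
If `D` is generated by `g` and the exceptional divisor by `e`, then `g = e * g'` and the proper
transform is generated by `g'` (this is the replacement rule `g → e g` of the blow-up). -/
noncomputable def properTransform (I D : X.IdealSheafData) : (blowUp I).IdealSheafData :=
  sSup {J | J * I.comap (blowUpMap I) ≤ D.comap (blowUpMap I)}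

/-- The composite of two successive blow-ups, the first along `I` and the second along an ideal
sheaf `J` on the blow-up along `I`, as a scheme over `X`. -/
noncomputable def blowUpTwice (I : X.IdealSheafData) (J : (blowUp I).IdealSheafData) : Over X :=
  Over.mk (blowUpMap J ≫ blowUpMap I)

/-- `B_{i,j}`: blow up `(y, v_i)`, then `(s, v_j)`. -/
noncomputable def esoleYau (y s : X.IdealSheafData) (v : Fin 3 → X.IdealSheafData)
    (i j : Fin 3) : Over X :=
  blowUpTwice (y ⊔ v i) ((s ⊔ v j).comap (blowUpMap (y ⊔ v i)))

/-- The resolution `(n,a)(n,b)`, where `w` is `y` for `n = 1` and `s` for `n = 2`: blow up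
`(w, v_a)`, then `(w', v_b)` with `w'` the proper transform of `w`. -/
noncomputable def hlsn (w : X.IdealSheafData) (v : Fin 3 → X.IdealSheafData)
    (a b : Fin 3) : Over X :=
  blowUpTwice (w ⊔ v a)
    (properTransform (w ⊔ v a) w ⊔ (v b).comap (blowUpMap (w ⊔ v a)))

/-- Names of the coordinates `y, s, v₁, v₂, v₃` of affine five-space. -/
inductive Coord : Type
  | y : Coord
  | s : Coord
  | v (i : Fin 3) : Coord

/-- The coordinate ring `ℂ[y, s, v₁, v₂, v₃] / (y s - v₁ v₂ v₃)`. -/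
abbrev BinomialRing : Type :=
  MvPolynomial Coord ℂ ⧸ Ideal.span {(MvPolynomial.X Coord.y * MvPolynomial.X Coord.s -
    MvPolynomial.X (Coord.v 0) * MvPolynomial.X (Coord.v 1) * MvPolynomial.X (Coord.v 2) :
      MvPolynomial Coord ℂ)}

/-- The binomial variety `V(y s - v₁ v₂ v₃)` in affine five-space over `ℂ`. -/
noncomputable abbrev binomialVariety : Scheme.{0} := Spec (CommRingCat.of BinomialRing)

/-- The ideal sheaf on the binomial variety generated by a coordinate function. -/
noncomputable def coordIdeal (c : Coord) : binomialVariety.IdealSheafData :=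
  Scheme.IdealSheafData.ofIdealTop (Ideal.span
    {(Scheme.ΓSpecIso (CommRingCat.of BinomialRing)).inv
      (Ideal.Quotient.mk _ (MvPolynomial.X c))})

end BinomialBlowup

open BlowupAux BinomialBlowup

/-!
The universal property of the blow-up reduces everything to an identity between ideals.

Write `E` for the ideal of the exceptional divisor of the blow-up of `(y, v i)`, and
`y = y' E`, `v i = v' E` for the total transforms; then `y' + v' = 1`. Cancelling `E` from
`y s = v i * v j * v k` gives `y' s = v' * v j * v k`, and hence
`y' * (s, v j) = v j * (v' * v k, y') = v j * (y', v k)` (`mul_sup_eq_mul_sup`).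
The ideals `(s, v j)` and `(y', v k)` therefore have a common multiple by invertible ideals. Total
transforms of effective Cartier divisors under a blow-up are effective Cartier divisors
(`IsInvertible.comap_blowUpMap`), and factors of invertible ideals are invertible
(`IsInvertible.of_mul_left`), so each of the two ideals becomes invertible on the blow-up of the
other, and the two blow-ups agree (`nonempty_blowUp_iso_of_mul_eq`). This is the isomorphism of
`B_{i,j}` with `(1,i)(1,k)`.

Blowing up `(y, v i)` and `(s, v j)` in either order gives the same scheme over `X`
(`nonempty_blowUpTwice_comm`), so exchanging `y` with `s` and `i` with `j` gives the isomorphism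
with `(2,j)(2,k)`.

For the binomial variety it remains to see that the coordinates are nonzerodivisors: each of them is
a prime element of the polynomial ring not dividing the equation (`mk_X_mem_nonZeroDivisors`).
-/

namespace BlowupAux

variable {X Z : Scheme.{u}}

/-! ### Products of ideal sheaves and invertibility -/

lemma exists_affine_le_preimage (f : Z ⟶ X) (z : Z) :
    ∃ (U : X.affineOpens) (W : Z.affineOpens), z ∈ W.1 ∧ W.1 ≤ f ⁻¹ᵁ U.1 := by
  obtain ⟨U, hU, hzU, -⟩ := exists_isAffineOpen_mem_and_subset (x := f z) (U := ⊤) trivial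
  obtain ⟨W, hW, hzW, hWU⟩ := exists_isAffineOpen_mem_and_subset (x := z) (U := f ⁻¹ᵁ U) hzU
  exact ⟨⟨U, hU⟩, ⟨W, hW⟩, hzW, hWU⟩

lemma idealSheaf_le_of_mem {I J : X.IdealSheafData} (U : X → X.affineOpens)
    (hU : ∀ x, x ∈ (U x).1) (h : ∀ x, I.ideal (U x) ≤ J.ideal (U x)) : I ≤ J :=
  Scheme.IdealSheafData.le_of_iSup_eq_top U
    (top_le_iff.mp fun x _ => TopologicalSpace.Opens.mem_iSup.mpr ⟨x, hU x⟩) h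

lemma comap_mul (f : Z ⟶ X) (I J : X.IdealSheafData) :
    (I * J).comap f = I.comap f * J.comap f := by
  choose U W hz hW using exists_affine_le_preimage f
  have h : ∀ z, ((I * J).comap f).ideal (W z) = (I.comap f * J.comap f).ideal (W z) := fun z => by
    simp only [Scheme.IdealSheafData.ideal_mul, Pi.mul_apply, comap_ideal f _ (U z) (W z) (hW z),
      Ideal.map_mul]
  exact le_antisymm (idealSheaf_le_of_mem W hz fun z => (h z).le)
    (idealSheaf_le_of_mem W hz fun z => (h z).ge)

lemma ideal_restrict_span {I : X.IdealSheafData} {U V : X.affineOpens} (h : V.1 ≤ U.1)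
    {g : Γ(X, U.1)} (hg : g ∈ nonZeroDivisors Γ(X, U.1)) (hI : I.ideal U = Ideal.span {g}) :
    ∃ g' ∈ nonZeroDivisors Γ(X, V.1), I.ideal V = Ideal.span {g'} := by
  have e : V.1 ≤ (𝟙 X : X ⟶ X) ⁻¹ᵁ U.1 := by simpa using h
  refine ⟨_, nzd_appLE (𝟙 X) U.2 V.2 e hg, ?_⟩
  have h1 := comap_ideal (𝟙 X) I U V e
  rwa [Scheme.IdealSheafData.comap_id, hI, Ideal.map_span, Set.image_singleton] at h1

lemma IsInvertible.mul {I J : X.IdealSheafData} (hI : IsInvertible I) (hJ : IsInvertible J) :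
    IsInvertible (I * J) := by
  intro x
  obtain ⟨U, hxU, g, hg, hIg⟩ := hI x
  obtain ⟨V, hxV, hVU, g', hg', hJg⟩ := hJ.shrink x U.1 hxU
  obtain ⟨g'', hg'', hIg''⟩ := ideal_restrict_span hVU hg hIg
  refine ⟨V, hxV, g'' * g', mul_mem hg'' hg', ?_⟩
  simp only [Scheme.IdealSheafData.ideal_mul, Pi.mul_apply]
  rw [hIg'', hJg, Ideal.span_singleton_mul_span_singleton]

lemma IsInvertible.le_of_mul_le_mul_right {E : X.IdealSheafData} (hE : IsInvertible E)
    {J K : X.IdealSheafData} (h : J * E ≤ K * E) : J ≤ K := by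
  choose U hU g hg hEg using hE
  refine idealSheaf_le_of_mem U hU fun x => ?_
  have h1 : J.ideal (U x) * E.ideal (U x) ≤ K.ideal (U x) * E.ideal (U x) := h (U x)
  rw [hEg x] at h1
  intro a ha
  obtain ⟨b, hb, e⟩ := Ideal.mem_mul_span_singleton.mp
    (h1 (Ideal.mul_mem_mul ha (Ideal.mem_span_singleton_self _)))
  rwa [← (mul_cancel_right_mem_nonZeroDivisors (hg x)).mp e]

lemma IsInvertible.mul_right_cancel {E : X.IdealSheafData} (hE : IsInvertible E)
    {J K : X.IdealSheafData} (h : J * E = K * E) : J = K :=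
  le_antisymm (hE.le_of_mul_le_mul_right h.le) (hE.le_of_mul_le_mul_right h.ge)

/-- If a product of two ideals is generated by a nonzerodivisor `n`, then the ratios of the products
`a * b` to `n` generate the unit ideal. -/
lemma span_ratio_eq_top {B : Type u} [CommRing B] {I J : Ideal B} {n : B}
    (hn : n ∈ nonZeroDivisors B) (h : I * J = Ideal.span {n}) :
    Ideal.span {c : B | ∃ a ∈ I, ∃ b ∈ J, a * b = n * c} = ⊤ := by
  have h1 : I * J ≤ Ideal.span {n} * Ideal.span {c : B | ∃ a ∈ I, ∃ b ∈ J, a * b = n * c} := by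
    refine Ideal.mul_le.mpr fun a ha b hb => ?_
    obtain ⟨c, hc⟩ := Ideal.mem_span_singleton.mp (h ▸ Ideal.mul_mem_mul ha hb)
    rw [hc]
    exact Ideal.mul_mem_mul (Ideal.mem_span_singleton_self n) (Ideal.subset_span ⟨a, ha, b, hb, hc⟩)
  obtain ⟨d, hd, e⟩ := Ideal.mem_span_singleton_mul.mp
    (h1 (h ▸ Ideal.mem_span_singleton_self n))
  have : d = 1 := (mul_cancel_left_mem_nonZeroDivisors hn).mp (by rw [e, mul_one])
  exact (Ideal.eq_top_iff_one _).mpr (this ▸ hd)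

lemma eq_span_of_mul_eq_span {B : Type u} [CommRing B] {I J : Ideal B} {n a b : B}
    (hn : n ∈ nonZeroDivisors B) (h : I * J = Ideal.span {n}) (ha : a ∈ I) (hb : b ∈ J)
    (hu : a * b ∣ n) :
    a ∈ nonZeroDivisors B ∧ I = Ideal.span {a} := by
  obtain ⟨c, hc⟩ := hu
  have hab : a ∈ nonZeroDivisors B ∧ b ∈ nonZeroDivisors B :=
    mul_mem_nonZeroDivisors.mp (mul_mem_nonZeroDivisors.mp (hc ▸ hn)).1
  refine ⟨hab.1, le_antisymm (fun x hx => ?_) ((Ideal.span_singleton_le_iff_mem _).mpr ha)⟩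
  obtain ⟨d, hd⟩ := Ideal.mem_span_singleton.mp (h ▸ Ideal.mul_mem_mul hx hb)
  refine Ideal.mem_span_singleton.mpr ⟨c * d, ?_⟩
  refine (mul_cancel_right_mem_nonZeroDivisors hab.2).mp ?_
  rw [hd, hc]; ring

lemma exists_mem_basicOpen_of_span_eq_top {U : X.Opens} {S : Set Γ(X, U)}
    (hS : Ideal.span S = ⊤) {x : X} (hx : x ∈ U) : ∃ c ∈ S, x ∈ X.basicOpen c := by
  by_contra! hcon
  have h4 : Ideal.span S ≤
      (IsLocalRing.maximalIdeal (X.presheaf.stalk x)).comap (X.presheaf.germ U x hx).hom := by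
    rw [Ideal.span_le]
    intro c hc
    have := hcon c hc
    rwa [Scheme.mem_basicOpen _ _ x hx] at this
  have h5 := h4 (hS ▸ Submodule.mem_top : (1 : Γ(X, U)) ∈ Ideal.span S)
  rw [Ideal.mem_comap, map_one] at h5
  exact (Ideal.ne_top_iff_one _).mp (IsLocalRing.maximalIdeal.isMaximal _).ne_top h5

/-- An ideal sheaf dividing an invertible ideal sheaf is invertible: where a product `a * b` of
sections of the two factors generates the product, `a` generates the first factor. -/
lemma IsInvertible.of_mul_left {I J : X.IdealSheafData} (h : IsInvertible (I * J)) :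
    IsInvertible I := by
  intro x
  obtain ⟨U, hxU, n, hn, hIJ⟩ := h x
  obtain ⟨c, ⟨a, ha, b, hb, hab⟩, hxc⟩ :=
    exists_mem_basicOpen_of_span_eq_top (span_ratio_eq_top hn hIJ) hxU
  let W : X.affineOpens := ⟨X.basicOpen c, U.2.basicOpen c⟩
  let ρ := X.presheaf.map (homOfLE (X.basicOpen_le c)).op
  have hres : ∀ K : X.IdealSheafData, (K.ideal U).map ρ.hom = K.ideal W := fun K =>
    Scheme.IdealSheafData.map_ideal K (U := W) (V := U) (X.basicOpen_le c)
  obtain ⟨u, hu⟩ : IsUnit (ρ c) := RingedSpace.isUnit_res_basicOpen _ c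
  have hW : (I * J).ideal W = Ideal.span {ρ n} := by
    rw [← hres, hIJ, Ideal.map_span, Set.image_singleton]
  obtain ⟨n', hn', hW'⟩ := ideal_restrict_span (V := W) (X.basicOpen_le c) hn hIJ
  have key : ρ a * ρ b = ρ n * u := by rw [hu, ← map_mul, ← map_mul, hab]
  obtain ⟨h1, h2⟩ := eq_span_of_mul_eq_span (a := ρ a) (b := ρ b)
    (nzd_of_span_eq hn' (hW'.symm.trans hW)) hW (hres I ▸ Ideal.mem_map_of_mem ρ.hom ha)
    (hres J ▸ Ideal.mem_map_of_mem ρ.hom hb)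
    ⟨(u⁻¹ : Units _).1, by rw [key, mul_assoc, Units.mul_inv, mul_one]⟩
  exact ⟨W, hxc, _, h1, h2⟩

lemma IsInvertible.of_mul_right {I J : X.IdealSheafData} (h : IsInvertible (I * J)) :
    IsInvertible J :=
  IsInvertible.of_mul_left (mul_comm I J ▸ h)

/-! ### Division by an invertible ideal sheaf -/

lemma IsInvertible.fg_ideal {E : X.IdealSheafData} (hE : IsInvertible E) (U : X.affineOpens) :
    (E.ideal U).FG := by
  choose V hV g _ hg using hE
  induction U using of_affine_open_cover V
    (top_le_iff.mp fun x _ => TopologicalSpace.Opens.mem_iSup.mpr ⟨x, hV x⟩) with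
  | basicOpen U f h =>
    rw [← E.map_ideal_basicOpen U f]
    exact h.map _
  | openCover U s hs h =>
    have := U.2.isLocalization_basicOpen
    refine Submodule.of_localizationSpan' (s : Set Γ(X, U.1)) hs
      (Mₚ := fun r => Γ(X, X.basicOpen r.1)) (Rₚ := fun r => Γ(X, X.basicOpen r.1))
      (fun r => Algebra.linearMap Γ(X, U.1) Γ(X, X.basicOpen r.1)) fun r => ?_
    rw [Ideal.localized'_eq_map]
    have := h r
    rw [← E.map_ideal_basicOpen U r] at this
    exact this
  | hU x => exact ⟨{g x}, by rw [hg x]; simp⟩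

/-- Formation of the quotient by a finitely generated ideal commutes with localization. -/
lemma map_colon_away {A B : Type u} [CommRing A] [CommRing B] [Algebra A B] (f : A)
    [IsLocalization.Away f B] (D E : Ideal A) (hE : E.FG) :
    (D.colon (E : Set A)).map (algebraMap A B) =
      (D.map (algebraMap A B)).colon (E.map (algebraMap A B) : Set B) := by
  apply le_antisymm
  · rw [Ideal.map_le_iff_le_comap]
    intro x hx
    rw [Ideal.mem_comap, Submodule.mem_colon]
    intro e he
    have h1 : Ideal.span {x} * E ≤ D := by
      rw [Ideal.span_singleton_mul_le_iff]; exact fun z hz => Submodule.mem_colon.mp hx z hz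
    have h2 := Ideal.map_mono (f := algebraMap A B) h1
    rw [Ideal.map_mul] at h2
    exact h2 (Ideal.mul_mem_mul (Ideal.mem_map_of_mem _ (Ideal.mem_span_singleton_self x)) he)
  · intro x hx
    obtain ⟨S, rfl⟩ := hE
    obtain ⟨a, s, rfl⟩ := IsLocalization.exists_mk'_eq (Submonoid.powers f) x
    have h1 : ∀ e ∈ S, ∃ m : ℕ, f ^ m * (e * a) ∈ D := by
      intro e he
      have h := Submodule.mem_colon.mp hx (algebraMap A B e)
        (Ideal.mem_map_of_mem _ (Ideal.subset_span he))
      rw [smul_eq_mul, mul_comm, IsLocalization.mul_mk'_eq_mk'_of_mul,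
        IsLocalization.mk'_mem_map_algebraMap_iff] at h
      obtain ⟨_, ⟨m, rfl⟩, hm⟩ := h
      exact ⟨m, hm⟩
    choose! m hm using h1
    rw [IsLocalization.mk'_mem_map_algebraMap_iff]
    -- Finitely many generators: the largest exponent serves them all.
    refine ⟨f ^ S.sup m, ⟨_, rfl⟩, ?_⟩
    have h2 : Ideal.span (S : Set A) * Ideal.span {f ^ S.sup m * a} ≤ D := by
      rw [Ideal.span_mul_span', Ideal.span_le]
      rintro _ ⟨e, he, _, rfl, rfl⟩
      have h3 : e * (f ^ S.sup m * a) = f ^ (S.sup m - m e) * (f ^ m e * (e * a)) := by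
        rw [← mul_assoc (f ^ _), pow_sub_mul_pow _ (Finset.le_sup he)]; ring
      change e * (f ^ S.sup m * a) ∈ D
      rw [h3]
      exact Ideal.mul_mem_left _ _ (hm e he)
    refine Submodule.mem_colon.mpr fun e he => ?_
    rw [smul_eq_mul, mul_comm]
    exact h2 (Ideal.mul_mem_mul he (Ideal.mem_span_singleton_self _))

/-- Division by an invertible ideal sheaf: an ideal sheaf contained in it is a multiple of it. -/
lemma IsInvertible.exists_mul_eq {D E : X.IdealSheafData} (hE : IsInvertible E) (h : D ≤ E) :
    ∃ Q : X.IdealSheafData, Q * E = D := by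
  let Q : X.IdealSheafData :=
    { ideal := fun U => (D.ideal U).colon (E.ideal U : Set Γ(X, U.1))
      map_ideal_basicOpen := fun U f => by
        have := U.2.isLocalization_basicOpen f
        rw [← D.map_ideal_basicOpen, ← E.map_ideal_basicOpen]
        exact map_colon_away f _ _ (hE.fg_ideal U) }
  refine ⟨Q, le_antisymm (fun U => ?_) ?_⟩
  · exact Ideal.mul_le.mpr fun q hq e he => Submodule.mem_colon.mp hq e he
  -- `id` keeps `hE`, on which `Q` depends, in the context.
  · choose V hV g _ hg using id hE
    refine idealSheaf_le_of_mem V hV fun x d hd => ?_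
    have hd' := h (V x) hd
    rw [hg x] at hd'
    obtain ⟨q, rfl⟩ := Ideal.mem_span_singleton'.mp hd'
    refine Ideal.mul_mem_mul (Submodule.mem_colon.mpr fun e he => ?_)
      (hg x ▸ Ideal.mem_span_singleton_self _)
    rw [SetLike.mem_coe, hg x] at he
    obtain ⟨r, rfl⟩ := Ideal.mem_span_singleton'.mp he
    rw [smul_eq_mul, mul_left_comm]
    exact Ideal.mul_mem_left _ _ hd

end BlowupAux

namespace BinomialBlowup

variable {X : Scheme.{u}}

/-! ### Total transforms of effective Cartier divisors -/

lemma isInvertible_top : IsInvertible (⊤ : X.IdealSheafData) := fun x => by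
  obtain ⟨U, hU, hxU, -⟩ := exists_isAffineOpen_mem_and_subset (x := x) (U := ⊤) trivial
  exact ⟨⟨U, hU⟩, hxU, 1, one_mem _, by simp [Ideal.span_singleton_one]⟩

lemma comap_ι_basicOpen_eq_top (I : X.IdealSheafData) {U : X.affineOpens} {a : Γ(X, U.1)}
    (ha : a ∈ I.ideal U) : I.comap (X.basicOpen a).ι = ⊤ := by
  have hV : IsAffineOpen (X.basicOpen a) := U.2.basicOpen a
  have : IsAffine (X.basicOpen a).toScheme := hV
  have h1 : I.ideal ⟨X.basicOpen a, hV⟩ = ⊤ := by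
    rw [← Scheme.IdealSheafData.map_ideal I (U := ⟨X.basicOpen a, hV⟩) (V := U) (X.basicOpen_le a)]
    exact Ideal.eq_top_of_isUnit_mem _ (Ideal.mem_map_of_mem _ ha)
      (RingedSpace.isUnit_res_basicOpen _ a)
  apply Scheme.IdealSheafData.ext_of_isAffine
  rw [comap_ideal (X.basicOpen a).ι I ⟨_, hV⟩ ⟨⊤, isAffineOpen_top _⟩ (by simp), h1,
    Ideal.map_top]
  rfl

/-- The blow-up is an isomorphism over an open set on which its centre is empty. -/
lemma isIso_blowUpMap_restrict (I : X.IdealSheafData) (V : X.Opens) (hV : I.comap V.ι = ⊤) :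
    IsIso (blowUpMap I ∣_ V) := by
  obtain ⟨σ, hσ, -⟩ := blowUp_existsUnique_lift I V.ι (hV ▸ isInvertible_top)
  have hr : Set.range σ ⊆ Set.range (blowUpMap I ⁻¹ᵁ V).ι := by
    rintro _ ⟨x, rfl⟩
    have h : (σ ≫ blowUpMap I) x ∈ V := by rw [hσ]; exact x.2
    rw [Scheme.Opens.range_ι]
    exact h
  let τ := IsOpenImmersion.lift (blowUpMap I ⁻¹ᵁ V).ι σ hr
  have hτ : τ ≫ (blowUpMap I ⁻¹ᵁ V).ι = σ := IsOpenImmersion.lift_fac _ _ _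
  refine ⟨τ, ?_, ?_⟩
  · rw [← cancel_mono (blowUpMap I ⁻¹ᵁ V).ι, Category.assoc, hτ, Category.id_comp]
    refine (blowUp_existsUnique_lift I ((blowUpMap I ⁻¹ᵁ V).ι ≫ blowUpMap I) ?_).unique ?_ rfl
    · rw [← morphismRestrict_ι, Scheme.IdealSheafData.comap_comp, hV,
        Scheme.IdealSheafData.comap_top]
      exact isInvertible_top
    · rw [Category.assoc, hσ, morphismRestrict_ι]
  · rw [← cancel_mono V.ι, Category.assoc, morphismRestrict_ι, ← Category.assoc, hτ, hσ,
      Category.id_comp]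

/-- Nonzerodivisors on the base stay nonzerodivisors on the blow-up: this is clear away from the
exceptional divisor, which is cut out by a nonzerodivisor. -/
lemma nzd_blowUpMap_appLE (I : X.IdealSheafData) (U : X.affineOpens) (a : Γ(X, U.1))
    (ha : a ∈ I.ideal U) (W : (blowUp I).affineOpens) (e : W.1 ≤ blowUpMap I ⁻¹ᵁ U.1)
    (haW : (blowUpMap I).appLE U.1 W.1 e a ∈ nonZeroDivisors Γ(blowUp I, W.1))
    {d : Γ(X, U.1)} (hd : d ∈ nonZeroDivisors Γ(X, U.1)) :
    (blowUpMap I).appLE U.1 W.1 e d ∈ nonZeroDivisors Γ(blowUp I, W.1) := by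
  have := isIso_blowUpMap_restrict I _ (comap_ι_basicOpen_eq_top I ha)
  let W' := (blowUp I).basicOpen ((blowUpMap I).appLE U.1 W.1 e a)
  have hW' : IsAffineOpen W' := W.2.basicOpen _
  have : IsAffine W'.toScheme := hW'
  have hW'W : W' ≤ W.1 := (blowUp I).basicOpen_le _
  have hW'V : W' ≤ blowUpMap I ⁻¹ᵁ X.basicOpen a := by
    have := Scheme.basicOpen_appLE (blowUpMap I) W.1 U.1 e a
    exact this.trans_le inf_le_right
  -- On `W'`, where `a` is invertible, the map to `X` is an open immersion, hence flat.
  have hj : IsOpenImmersion (W'.ι ≫ blowUpMap I) := by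
    have h : W'.ι ≫ blowUpMap I =
        (blowUp I).homOfLE hW'V ≫ (blowUpMap I ∣_ X.basicOpen a) ≫ (X.basicOpen a).ι := by
      rw [morphismRestrict_ι, Scheme.homOfLE_ι_assoc]
    rw [h]; infer_instance
  have e1 : ⊤ ≤ W'.ι ⁻¹ᵁ W.1 := by
    rw [← Scheme.Opens.ι_preimage_self W']; exact W'.ι.preimage_mono hW'W
  have e2 : ⊤ ≤ (W'.ι ≫ blowUpMap I) ⁻¹ᵁ U.1 := e1.trans (W'.ι.preimage_mono e)
  -- Sections on `W` inject into sections on `W'`, as `a` is a nonzerodivisor on `W`.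
  have hinj : Function.Injective (W'.ι.appLE W.1 ⊤ e1).hom := by
    have hloc := W.2.isLocalization_basicOpen ((blowUpMap I).appLE U.1 W.1 e a)
    have h1 : Function.Injective ((blowUp I).presheaf.map (homOfLE hW'W).op).hom :=
      IsLocalization.injective (M := Submonoid.powers ((blowUpMap I).appLE U.1 W.1 e a))
        Γ(blowUp I, W') (Submonoid.powers_le.mpr haW)
    have e0 : ⊤ ≤ W'.ι ⁻¹ᵁ W' := by simp
    have h2 : IsIso (W'.ι.appLE W' ⊤ e0) := isIso_appLE_open _ _ (by simp) _
    have h3 := (ConcreteCategory.bijective_of_isIso (W'.ι.appLE W' ⊤ e0)).1.comp h1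
    rw [← Scheme.Hom.map_appLE W'.ι e0 (homOfLE hW'W).op]
    exact h3
  have hd' := nzd_appLE (W'.ι ≫ blowUpMap I) U.2 (isAffineOpen_top _) e2 hd
  rw [← Scheme.Hom.appLE_comp_appLE W'.ι (blowUpMap I) U.1 W.1 ⊤ e e1] at hd'
  rw [mem_nonZeroDivisors_iff_right] at hd' ⊢
  intro b hb
  apply hinj
  rw [map_zero]
  apply hd'
  have := congrArg (W'.ι.appLE W.1 ⊤ e1).hom hb
  rw [map_mul, map_zero] at this
  exact this

/-- The total transform of an effective Cartier divisor under any blow-up is an effective Cartier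
divisor. -/
lemma _root_.BlowupAux.IsInvertible.comap_blowUpMap {D : X.IdealSheafData} (hD : IsInvertible D)
    (I : X.IdealSheafData) : IsInvertible (D.comap (blowUpMap I)) := by
  intro z
  obtain ⟨U, a, ha, hz⟩ := genLocus_cover I _ (isInvertible_comap_blowUpMap I) z
  obtain ⟨W, hzW, hW, e, -, hnzd⟩ := exists_nzd_gen I _ (isInvertible_comap_blowUpMap I) U a z hz
  obtain ⟨U', hzU', hU'U, d, hd, hDd⟩ := hD.shrink (blowUpMap I z) U.1 (e hzW)
  obtain ⟨W', hW', hzW', hW'W⟩ := exists_isAffineOpen_mem_and_subset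
    (x := z) (U := W ⊓ blowUpMap I ⁻¹ᵁ U'.1) ⟨hzW, hzU'⟩
  have l1 : W' ≤ W := fun w hw => (hW'W hw).1
  have l2 : W' ≤ blowUpMap I ⁻¹ᵁ U'.1 := fun w hw => (hW'W hw).2
  refine ⟨⟨W', hW'⟩, hzW', _, nzd_blowUpMap_appLE I U' (X.presheaf.map (homOfLE hU'U).op a)
    ?_ ⟨W', hW'⟩ l2 ?_ hd, ?_⟩
  · exact Scheme.IdealSheafData.ideal_le_comap_ideal I (U := U') (V := U) hU'U ha
  · have h1 := nzd_appLE (𝟙 _) hW hW' (by simpa using l1) hnzd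
    have h2 := Scheme.Hom.appLE_comp_appLE (𝟙 _) (blowUpMap I) U.1 W W' e (by simpa using l1)
    have h3 := Scheme.Hom.map_appLE (blowUpMap I) l2 (homOfLE hU'U).op
    have h4 : (blowUpMap I).appLE U'.1 W' l2 (X.presheaf.map (homOfLE hU'U).op a) =
        (blowUpMap I).appLE U.1 W' (l1.trans e) a := congrArg (fun t => t.hom a) h3
    have h5 := congrArg (fun t => t.hom a) h2
    simp only [Category.id_comp] at h5
    change (blowUpMap I).appLE U'.1 W' l2 (X.presheaf.map (homOfLE hU'U).op a) ∈ _
    rw [h4]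
    exact h5 ▸ h1
  · rw [comap_ideal _ D U' ⟨W', hW'⟩ l2, hDd, Ideal.map_span, Set.image_singleton]

/-! ### Comparison of blow-ups -/

lemma subsingleton_over_blowUp (I : X.IdealSheafData) (Z : Over X)
    (hZ : IsInvertible (I.comap Z.hom)) : Subsingleton (Z ⟶ Over.mk (blowUpMap I)) :=
  ⟨fun g h => Over.OverMorphism.ext
    ((blowUp_existsUnique_lift I Z.hom hZ).unique (Over.w g) (Over.w h))⟩

/-- Two ideal sheaves with equal invertible multiples have the same blow-up. -/
lemma nonempty_blowUp_iso_of_mul_eq {J K A C : X.IdealSheafData} (hA : IsInvertible A)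
    (hC : IsInvertible C) (h : A * J = C * K) :
    Nonempty (Over.mk (blowUpMap J) ≅ Over.mk (blowUpMap K)) := by
  -- The inverse image of the second ideal on the blow-up of the first divides an invertible ideal.
  have key : ∀ {J K A C : X.IdealSheafData}, IsInvertible A → A * J = C * K →
      IsInvertible (K.comap (blowUpMap J)) := by
    intro J K A C hA h
    have h1 := (hA.comap_blowUpMap J).mul (isInvertible_comap_blowUpMap J)
    rw [← comap_mul, h, comap_mul] at h1
    exact h1.of_mul_right
  obtain ⟨g, hg, -⟩ := blowUp_existsUnique_lift K (blowUpMap J) (key hA h)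
  obtain ⟨g', hg', -⟩ := blowUp_existsUnique_lift J (blowUpMap K) (key hC h.symm)
  have := subsingleton_over_blowUp J (Over.mk (blowUpMap J)) (isInvertible_comap_blowUpMap J)
  have := subsingleton_over_blowUp K (Over.mk (blowUpMap K)) (isInvertible_comap_blowUpMap K)
  exact ⟨⟨Over.homMk g hg, Over.homMk g' hg', Subsingleton.elim _ _, Subsingleton.elim _ _⟩⟩

lemma blowUpTwice_isInvertible_left (I J : X.IdealSheafData) :
    IsInvertible (I.comap (blowUpTwice I (J.comap (blowUpMap I))).hom) := by
  have := (isInvertible_comap_blowUpMap I).comap_blowUpMap (J.comap (blowUpMap I))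
  rwa [← Scheme.IdealSheafData.comap_comp] at this

lemma blowUpTwice_isInvertible_right (I J : X.IdealSheafData) :
    IsInvertible (J.comap (blowUpTwice I (J.comap (blowUpMap I))).hom) := by
  have := isInvertible_comap_blowUpMap (J.comap (blowUpMap I))
  rwa [← Scheme.IdealSheafData.comap_comp] at this

lemma blowUpTwice_existsUnique_hom (I J : X.IdealSheafData) (Z : Over X)
    (hI : IsInvertible (I.comap Z.hom)) (hJ : IsInvertible (J.comap Z.hom)) :
    ∃! _ : Z ⟶ blowUpTwice I (J.comap (blowUpMap I)), True := by
  obtain ⟨g, hg, hg'⟩ := blowUp_existsUnique_lift I Z.hom hI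
  rw [← hg, Scheme.IdealSheafData.comap_comp] at hJ
  obtain ⟨h, hh, hh'⟩ := blowUp_existsUnique_lift _ g hJ
  refine ⟨Over.homMk h (by rw [← hg, ← hh, Category.assoc]; rfl), trivial, fun k _ => ?_⟩
  refine Over.OverMorphism.ext (hh' _ (hg' _ ?_))
  exact (Category.assoc _ _ _).trans (Over.w k)

/-- Blowing up two ideal sheaves of the base, one after the other, does not depend on the order:
both composites are terminal among the schemes on which both ideals become invertible. -/
lemma nonempty_blowUpTwice_comm (I J : X.IdealSheafData) :
    Nonempty (blowUpTwice I (J.comap (blowUpMap I)) ≅ blowUpTwice J (I.comap (blowUpMap J))) := by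
  have key := fun I J : X.IdealSheafData => blowUpTwice_existsUnique_hom I J _
    (blowUpTwice_isInvertible_left I J) (blowUpTwice_isInvertible_right I J)
  obtain ⟨g, -⟩ := blowUpTwice_existsUnique_hom J I _
    (blowUpTwice_isInvertible_right I J) (blowUpTwice_isInvertible_left I J)
  obtain ⟨g', -⟩ := blowUpTwice_existsUnique_hom I J _
    (blowUpTwice_isInvertible_right J I) (blowUpTwice_isInvertible_left J I)
  exact ⟨⟨g, g', (key I J).unique trivial trivial, (key J I).unique trivial trivial⟩⟩

/-! ### The two resolutions -/

lemma properTransform_mul {I D : X.IdealSheafData} (h : D ≤ I) :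
    properTransform I D * I.comap (blowUpMap I) = D.comap (blowUpMap I) := by
  have hI := isInvertible_comap_blowUpMap I
  obtain ⟨Q, hQ⟩ := hI.exists_mul_eq (Scheme.IdealSheafData.comap_mono (blowUpMap I) h)
  have : properTransform I D = Q := by
    refine le_antisymm (sSup_le fun J hJ => hI.le_of_mul_le_mul_right ?_) (le_sSup hQ.le)
    exact (show J * _ ≤ D.comap (blowUpMap I) from hJ).trans hQ.ge
  rw [this, hQ]

/-- If the ideals `Y` and `V` have sum `E` and quotients `y'` and `v'` by `E`, and `Y S = V A C`, then
`y' (S + A) = A (y' + C)`. Indeed `y' S = v' A C`, and `v' C + y' = C + y'` because `y' + v' = 1`. -/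
lemma mul_sup_eq_mul_sup {Y V E S A C y' v' : X.IdealSheafData} (hE : IsInvertible E)
    (hy' : y' * E = Y) (hv' : v' * E = V) (hYV : Y ⊔ V = E) (h : Y * S = V * A * C) :
    y' * (S ⊔ A) = A * (y' ⊔ C) := by
  have htop : y' ⊔ v' = ⊤ := by
    apply hE.mul_right_cancel
    rw [Scheme.IdealSheafData.inf_mul, hy', hv', hYV, Scheme.IdealSheafData.top_mul]
  have hrel : y' * S = v' * A * C := by
    apply hE.mul_right_cancel
    rw [mul_right_comm, hy', h, ← hv', mul_right_comm v', mul_right_comm (v' * A)]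
  have hC : v' * C ⊔ y' = y' ⊔ C := by
    have h2 : y' * C ≤ y' := fun U => Ideal.mul_le_left
    calc v' * C ⊔ y' = y' ⊔ y' * C ⊔ v' * C := by rw [sup_eq_left.mpr h2, sup_comm]
      _ = y' ⊔ C := by
        rw [sup_assoc, ← Scheme.IdealSheafData.inf_mul, htop, Scheme.IdealSheafData.top_mul]
  rw [← hC, Scheme.IdealSheafData.mul_inf, Scheme.IdealSheafData.mul_inf, hrel, mul_comm A y',
    mul_left_comm A, mul_assoc]

/-- After the blow-up of `(y, v i)`, the ideals `(s, v j)` and `(y', v k)` have equal invertible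
multiples: `y' * (s, v j) = v j * (y', v k)`. -/
theorem nonempty_esoleYau_iso_hlsn {y s : X.IdealSheafData} {v : Fin 3 → X.IdealSheafData}
    {i j k : Fin 3} (hy : IsInvertible y) (hvj : IsInvertible (v j))
    (h : y * s = v i * v j * v k) : Nonempty (esoleYau y s v i j ≅ hlsn y v i k) := by
  have hE := isInvertible_comap_blowUpMap (y ⊔ v i)
  have hy' := properTransform_mul (le_sup_left : y ≤ y ⊔ v i)
  obtain ⟨v', hv'⟩ := hE.exists_mul_eq
    (Scheme.IdealSheafData.comap_mono (blowUpMap (y ⊔ v i)) (le_sup_right : v i ≤ y ⊔ v i))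
  have key := mul_sup_eq_mul_sup (S := s.comap (blowUpMap (y ⊔ v i)))
    (A := (v j).comap (blowUpMap (y ⊔ v i))) (C := (v k).comap (blowUpMap (y ⊔ v i)))
    hE hy' hv' (Scheme.IdealSheafData.comap_sup _ _ _).symm
    (by rw [← comap_mul, h, comap_mul, comap_mul])
  rw [← Scheme.IdealSheafData.comap_sup] at key
  have hy'inv : IsInvertible (properTransform (y ⊔ v i) y) :=
    IsInvertible.of_mul_left (hy'.symm ▸ hy.comap_blowUpMap (y ⊔ v i))
  obtain ⟨e⟩ := nonempty_blowUp_iso_of_mul_eq hy'inv (hvj.comap_blowUpMap (y ⊔ v i)) key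
  exact ⟨(Over.map (blowUpMap (y ⊔ v i))).mapIso e⟩

/-- Both isomorphisms, for a general base; the second is the first with `y` and `s` exchanged, as
the two blow-ups defining the Esole–Yau resolution commute. -/
theorem nonempty_isos {y s : X.IdealSheafData} {v : Fin 3 → X.IdealSheafData}
    {i j k : Fin 3} (hij : i ≠ j) (hjk : j ≠ k) (hik : i ≠ k) (hy : IsInvertible y)
    (hs : IsInvertible s) (hv : ∀ m, IsInvertible (v m)) (h : y * s = v 0 * v 1 * v 2) :
    Nonempty (esoleYau y s v i j ≅ hlsn y v i k) ∧
      Nonempty (esoleYau y s v i j ≅ hlsn s v j k) := by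
  have h' : y * s = v i * v j * v k := by
    rw [h]
    fin_cases i <;> fin_cases j <;> fin_cases k <;> simp at hij hjk hik ⊢ <;> ring
  refine ⟨nonempty_esoleYau_iso_hlsn hy (hv j) h', ?_⟩
  obtain ⟨e⟩ := nonempty_blowUpTwice_comm (y ⊔ v i) (s ⊔ v j)
  obtain ⟨e'⟩ := nonempty_esoleYau_iso_hlsn (y := s) (s := y) (v := v) (i := j) (j := i) (k := k)
    hs (hv i) (by rw [mul_comm, h']; ring)
  exact ⟨e ≪≫ e'⟩

/-! ### The binomial variety -/

/-- The equation `y s - v₁ v₂ v₃` of the binomial variety. -/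
noncomputable abbrev binomial : MvPolynomial Coord ℂ :=
  MvPolynomial.X Coord.y * MvPolynomial.X Coord.s -
    MvPolynomial.X (Coord.v 0) * MvPolynomial.X (Coord.v 1) * MvPolynomial.X (Coord.v 2)

lemma X_not_dvd_binomial (c : Coord) : ¬ MvPolynomial.X c ∣ binomial := by
  classical
  -- A point of the hyperplane `c = 0` outside of the binomial variety.
  have h : ∃ x : Coord → ℂ, x c = 0 ∧ MvPolynomial.eval x binomial ≠ 0 := by
    rcases c with _ | _ | m
    · exact ⟨fun | .y => 0 | _ => 1, rfl, by simp⟩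
    · exact ⟨fun | .s => 0 | _ => 1, rfl, by simp⟩
    · exact ⟨fun | .v _ => 0 | _ => 1, rfl, by simp⟩
  obtain ⟨x, hx, hb⟩ := h
  rintro ⟨q, hq⟩
  rw [hq, map_mul, MvPolynomial.eval_X, hx, zero_mul] at hb
  exact hb rfl

/-- The coordinate functions on the binomial variety are nonzerodivisors: a coordinate is a prime
element of the polynomial ring that does not divide the equation. -/
lemma mk_X_mem_nonZeroDivisors (c : Coord) :
    (Ideal.Quotient.mk _ (MvPolynomial.X c) : BinomialRing) ∈ nonZeroDivisors BinomialRing := by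
  rw [mem_nonZeroDivisors_iff_right]
  intro f hf
  obtain ⟨f, rfl⟩ := Ideal.Quotient.mk_surjective f
  rw [← map_mul, Ideal.Quotient.eq_zero_iff_mem, Ideal.mem_span_singleton] at hf
  rw [Ideal.Quotient.eq_zero_iff_mem, Ideal.mem_span_singleton]
  obtain ⟨g, hg⟩ := hf
  have hp : Prime (MvPolynomial.X c : MvPolynomial Coord ℂ) := MvPolynomial.X_prime
  obtain ⟨q, rfl⟩ := (hp.dvd_or_dvd (hg ▸ dvd_mul_left _ _)).resolve_left (X_not_dvd_binomial c)
  exact ⟨q, mul_left_cancel₀ hp.ne_zero (by rw [mul_comm, hg]; ring)⟩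

lemma coordIdeal_ideal_top (c : Coord) : (coordIdeal c).ideal ⟨⊤, isAffineOpen_top _⟩ =
    Ideal.span {(Scheme.ΓSpecIso (CommRingCat.of BinomialRing)).inv
      (Ideal.Quotient.mk _ (MvPolynomial.X c))} := by
  simp [coordIdeal]

lemma isInvertible_coordIdeal (c : Coord) : IsInvertible (coordIdeal c) := fun x => by
  refine ⟨⟨⊤, isAffineOpen_top _⟩, trivial, _, ?_, coordIdeal_ideal_top c⟩
  let e := (Scheme.ΓSpecIso (CommRingCat.of BinomialRing)).symm.commRingCatIsoToRingEquiv
  exact nzd_map_of_flat e.toRingHom (.of_bijective e.bijective) (mk_X_mem_nonZeroDivisors c)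

lemma coordIdeal_relation : coordIdeal .y * coordIdeal .s =
    coordIdeal (.v 0) * coordIdeal (.v 1) * coordIdeal (.v 2) := by
  apply Scheme.IdealSheafData.ext_of_isAffine
  simp only [Scheme.IdealSheafData.ideal_mul, Pi.mul_apply, coordIdeal_ideal_top,
    Ideal.span_singleton_mul_span_singleton, ← map_mul]
  congr 3
  exact Ideal.Quotient.eq.mpr (Ideal.mem_span_singleton_self _)

end BinomialBlowup

/-- Here `i, j, k` are the three distinct elements of `Fin 3`, and `v 0, v 1, v 2` stand for
`v₁, v₂, v₃`. The first part is for five effective Cartier divisors `y, s, v 0, v 1, v 2` with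
`y s = v₁ v₂ v₃` on any scheme, the second for the binomial variety itself. The isomorphisms are
isomorphisms over the scheme that is blown up. -/
theorem mainTheorem2 (i j k : Fin 3) (hij : i ≠ j) (hjk : j ≠ k) (hik : i ≠ k) :
    (∀ (X : Scheme.{u}) (y s : X.IdealSheafData) (v : Fin 3 → X.IdealSheafData),
      IsInvertible y → IsInvertible s → (∀ m, IsInvertible (v m)) →
      y * s = v 0 * v 1 * v 2 →
        Nonempty (esoleYau y s v i j ≅ hlsn y v i k) ∧
        Nonempty (esoleYau y s v i j ≅ hlsn s v j k)) ∧
    Nonempty (esoleYau (coordIdeal .y) (coordIdeal .s) (fun m => coordIdeal (.v m)) i j ≅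
      hlsn (coordIdeal .y) (fun m => coordIdeal (.v m)) i k) ∧
    Nonempty (esoleYau (coordIdeal .y) (coordIdeal .s) (fun m => coordIdeal (.v m)) i j ≅
      hlsn (coordIdeal .s) (fun m => coordIdeal (.v m)) j k) := by
  exact ⟨fun X y s v hy hs hv h => nonempty_isos hij hjk hik hy hs hv h,
    nonempty_isos hij hjk hik (isInvertible_coordIdeal _) (isInvertible_coordIdeal _)
      (fun _ => isInvertible_coordIdeal _) coordIdeal_relation⟩
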